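/- **Proposition.** Let $d\in\mathbb N$ and let $\mathbb P$ be the space of Borel probability measures on $\mathbb R^d$, with the Borel $\sigma$-field $\mathcal P$ of the weak topology. For $p,q\in\mathbb P$ let $$\beta(p,q)=\sup\Big\{\int f\,dp-\int f\,dq:\ f:\mathbb R^d\to\mathbb R,\ \|f\|_{BL}\le 1\Big\},\qquad \|f\|_{BL}=\sup_x|f(x)|+\sup_{x\ne y}\frac{|f(x)-f(y)|}{\|x-y\|}$$ be the bounded Lipschitz distance, and for probability measures $Q_1,Q_2$ on $(\mathbb P,\mathcal P)$ let $$W_1(Q_1,Q_2)=\inf_\Gamma\int_{\mathbb P\times\mathbb P}\beta(p_1,p_2)\,\Gamma(dp_1\,dp_2),$$ the infimum being over all probability measures $\Gamma$ on $\mathbb P\times\mathbb P$ with marginals $Q_1$ and $Q_2$. For an integer $k\ge 3$ and $p\in\mathbb P$ set $$\Psi_k(p)=\Big(\sup_{\epsilon\in(0,1]}\epsilon^k\,N\big(\epsilon,\epsilon^{k/(k-2)},p\big)\Big)^{1/2}\in[0,+\infty],$$ where $N(\epsilon,\eta,p)$ is the minimal number of sets of diameter at most $2\epsilon$ which cover $\mathbb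 R^d$ except for a set $A$ with $p(A)\le\eta$. Let $(\xi_i)_{i\ge1}$ be an infinite exchangeable sequence of $\mathbb R^d$-valued random variables on a probability space $(\Omega,\mathcal F,P)$, directed by the random probability measure $\tilde p$ (that is, conditionally on $\tilde p$ the $\xi_i$ are independent with common distribution $\tilde p$). Write $\xi(n)=(\xi_1,\dots,\xi_n)$ and $\tilde e_N=\frac1N\sum_{i=1}^N\delta_{\xi_i}$, let $Q_{\xi(n)}$ be any version of the conditional distribution of $\tilde p$ given $\xi(n)$ (the posterior), and let $\mathcal L(\tilde e_N\mid\xi(n))$ be any version of the conditional distribution of $\tilde e_N$ given $\xi(n)$. If $\mathbb E[\Psi_k(\tilde p)]<+\infty$ for some integer $k\ge 3$, then $P$-almost surely $$Y:=\sup_{n\ge1}\mathbb E[\Psi_k(\tilde p)\mid\xi(n)]<+\infty,$$ and, for all integers $1\le n<N$, $$W_1\big(Q_{\xi(n)},\mathcal L(\tilde e_N\mid\xi(n))\big)\le\frac1{(N-n)^{1/k}}\Big(\frac43+4\cdot3^{2k}\,\mathbb E[\Psi_k(\tilde p)\mid\xi(n)]\Big)+\frac{2n}N\le\frac1{(N-n)^{1/k}}\Big(\frac43+4\cdot3^{2k}\,Y\Big)+\frac{2n}N.$$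 -/

import Mathlib

open MeasureTheory ProbabilityTheory
open scoped ENNReal

namespace FinitaryPosterior

noncomputable section

/-- The bounded Lipschitz norm `‖f‖_BL = sup_x |f x| + sup_{x ≠ y} |f x - f y| / d(x, y)`, with
values in `[0, ∞]` (the diagonal terms are `0 / 0 = 0`, so `x ≠ y` need not be required). -/
def blNorm {X : Type*} [MetricSpace X] (f : X → ℝ) : ℝ≥0∞ :=
  (⨆ x, ‖f x‖ₑ) + ⨆ x, ⨆ y, edist (f x) (f y) / edist x y

/-- The bounded Lipschitz distance
`β(p, q) = sup { ∫ f dp - ∫ f dq : ‖f‖_BL ≤ 1 }`. The supremum is nonnegative (take `f = 0`). -/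
def blDist {X : Type*} [MetricSpace X] [MeasurableSpace X] (p q : ProbabilityMeasure X) : ℝ≥0∞ :=
  ⨆ (f : X → ℝ) (_ : blNorm f ≤ 1),
    ENNReal.ofReal ((∫ x, f x ∂(p : Measure X)) - ∫ x, f x ∂(q : Measure X))

/-- The Gini-Kantorovich-Wasserstein distance of order one, relative to the bounded Lipschitz
distance, between probability measures on the space of probability measures on `X`: the infimum of
`∫ β(p₁, p₂) Γ(dp₁ dp₂)` over all `Γ` with marginals `Q₁` and `Q₂`. -/
def wasserstein {X : Type*} [MetricSpace X] [MeasurableSpace X]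
    (Q₁ Q₂ : Measure (ProbabilityMeasure X)) : ℝ≥0∞ :=
  ⨅ (Γ : Measure (ProbabilityMeasure X × ProbabilityMeasure X))
    (_ : Γ.map Prod.fst = Q₁ ∧ Γ.map Prod.snd = Q₂), ∫⁻ z, blDist z.1 z.2 ∂Γ

/-- `N(ε, η, p)`: the minimal number of sets of diameter at most `2 ε` that cover `X` except for a
set of `p`-measure at most `η` (`⊤` if no finite family does). -/
def coverNumber {X : Type*} [MetricSpace X] [MeasurableSpace X] (ε η : ℝ)
    (p : ProbabilityMeasure X) : ℕ∞ :=
  ⨅ (m : ℕ) (_ : ∃ U : Fin m → Set X,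
    (∀ i, Metric.ediam (U i) ≤ ENNReal.ofReal (2 * ε)) ∧
      (p : Measure X) (⋃ i, U i)ᶜ ≤ ENNReal.ofReal η), (m : ℕ∞)

/-- `Ψ_k(p) = (sup_{0 < ε ≤ 1} ε ^ k * N(ε, ε ^ (k / (k - 2)), p)) ^ (1 / 2)`, meant for
`k > 2`. -/
def Psi {X : Type*} [MetricSpace X] [MeasurableSpace X] (k : ℕ)
    (p : ProbabilityMeasure X) : ℝ≥0∞ :=
  (⨆ ε ∈ Set.Ioc (0 : ℝ) 1, ENNReal.ofReal (ε ^ k) *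
    (coverNumber ε (ε ^ ((k : ℝ) / ((k : ℝ) - 2))) p : ℝ≥0∞)) ^ (1 / 2 : ℝ)

/-- The empirical distribution `(1 / N) ∑_{i < N} δ_{x i}` of the first `N` terms of `x`. -/
def empirical {X : Type*} [MeasurableSpace X] (x : ℕ → X) (N : ℕ) (hN : 0 < N) :
    ProbabilityMeasure X :=
  ⟨(N : ℝ≥0∞)⁻¹ • ∑ i ∈ Finset.range N, Measure.dirac (x i), ⟨by
    simpa using ENNReal.inv_mul_cancel (Nat.cast_ne_zero.2 hN.ne') (ENNReal.natCast_ne_top N)⟩⟩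

/-- The first `n` observations, as a random vector (the sequence is indexed from `0`). -/
def initial {Ω X : Type*} (ξ : ℕ → Ω → X) (n : ℕ) (ω : Ω) : Fin n → X := fun i => ξ i ω

/-- `ξ` is an infinite exchangeable sequence directed by the random probability measure `pt`:
given `pt`, the `ξ i` are independent with common distribution `pt`. -/
structure IsDirectedBy {Ω X : Type*} [MeasurableSpace Ω] [MeasurableSpace X] (P : Measure Ω)
    (ξ : ℕ → Ω → X) (pt : Ω → ProbabilityMeasure X) : Prop where
  measurable_obs : ∀ i, Measurable (ξ i)
  measurable_pt : Measurable pt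
  condIID : ∀ (n : ℕ) (A : ℕ → Set X), (∀ i, MeasurableSet (A i)) →
    P⟦⋂ i ∈ Finset.range n, ξ i ⁻¹' A i | MeasurableSpace.comap pt inferInstance⟧ =ᵐ[P]
      fun ω => ∏ i ∈ Finset.range n, (pt ω : Measure X).real (A i)

/-- `E[Ψ_k(pt) | ξ(n)]`. -/
def condPsi {Ω X : Type*} [MeasurableSpace Ω] [MetricSpace X] [MeasurableSpace X] (P : Measure Ω)
    (ξ : ℕ → Ω → X) (pt : Ω → ProbabilityMeasure X) (k n : ℕ) : Ω → ℝ≥0∞ :=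
  condLExp (MeasurableSpace.comap (initial ξ n) inferInstance) P (fun ω => Psi k (pt ω))

end

end FinitaryPosterior

/-!
The posterior `Q x` is coupled with the conditional law of the empirical measure as follows: draw
`p` from `Q x`, then `r = N - n` further observations independently from `p`, and pair `p` with the
empirical measure of all `N` observations. That the second marginal is the right one almost surely
is `IsDirectedBy.ae_eq_map_empiricalOf`; it rests on the joint law of the directing measure and the
observations (`IsDirectedBy.hasCondDistrib_next`) and on the σ-algebra of the space of probability
measures being countably generated, which makes conditional distributions unique. Replacing the
empirical measure of all observations by that of the last `r` ones costs at most `2 n / N`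
(`blDist_empiricalOf_sumElim_le`), so that it remains to bound the mean bounded Lipschitz distance
between `p` and the empirical measure of a sample of size `r` from `p`. No measurability of the
bounded Lipschitz distance is needed: the lower integrals are only ever bounded from above.

The mean distance is at most `r ^ (-1 / k) * 3 ^ (2 k) * Ψ_k(p)`, by Dudley's chaining argument
(`lintegral_blDist_empiricalOf_le`). Finitely many scales `ε` are used, in geometric progression.
The exceptional sets of all scales are removed, and on the remaining set a test function is
telescoped along iterated discretizations (`abs_integral_sub_le_chain`). The part which belongs to
a scale with at most `b` cells contributes at most `√(b / r)` times the size of the increments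
there (`integral_cellDiff_le`). The exponent `k / (k - 2)` in `Ψ_k` makes the masses of the
exceptional sets and the deviation at the coarsest scale both of the order `r ^ (-1 / k)`.

Integration over the posterior turns `Ψ_k(p)` into `E[Ψ_k | ξ(n)]`, as `Ψ_k` is measurable
(`measurable_Psi`), and the supremum of these conditional expectations is finite almost surely
because they converge, by Lévy's upward theorem.
-/

namespace FinitaryPosterior

/-! ### Chaining along discretizations -/

/-- If `U 0, …, U (n - 1)` cover `G`, then `G` can be discretized: there is a measurable map from
`G` to at most `n` points of `G` that moves no point out of its set `U i`. -/
lemma exists_measurable_selector {X : Type*} [MeasurableSpace X] [Nonempty X] (G : Set X) (n : ℕ)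
    (U : Fin n → Set X) (hU : ∀ i, MeasurableSet (U i)) :
    ∃ (c : X → X) (F : Finset X), Measurable c ∧ F.card ≤ n ∧ (F : Set X) ⊆ G ∧
      ∀ x ∈ G ∩ ⋃ i, U i, c x ∈ F ∧ ∃ i, x ∈ U i ∧ c x ∈ U i := by
  classical
  induction n with
  | zero => exact ⟨id, ∅, measurable_id, by simp, by simp, by simp⟩
  | succ n ih =>
    obtain ⟨c, F, hc, hF, hFG, h⟩ := ih (fun i => U i.castSucc) fun i => hU _
    by_cases hne : (G ∩ U (Fin.last n)).Nonempty
    · obtain ⟨z, hzG, hzU⟩ := hne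
      refine ⟨(U (Fin.last n)).piecewise (fun _ => z) c, insert z F,
        Measurable.piecewise (hU _) measurable_const hc,
        (Finset.card_insert_le _ _).trans (by lia), ?_, ?_⟩
      · simpa [Set.insert_subset_iff] using ⟨hzG, hFG⟩
      · rintro x ⟨hxG, hxU⟩
        by_cases hx : x ∈ U (Fin.last n)
        · simp only [hx, Set.piecewise_eq_of_mem]
          exact ⟨Finset.mem_insert_self _ _, _, hx, hzU⟩
        · simp only [hx, not_false_eq_true, Set.piecewise_eq_of_notMem]
          obtain ⟨i, hi⟩ := Set.mem_iUnion.1 hxU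
          induction i using Fin.lastCases with
          | last => exact absurd hi hx
          | cast i =>
            obtain ⟨h1, j, h2⟩ := h x ⟨hxG, Set.mem_iUnion.2 ⟨i, hi⟩⟩
            exact ⟨Finset.mem_insert_of_mem h1, _, h2⟩
    · refine ⟨c, F, hc, by lia, hFG, ?_⟩
      rintro x ⟨hxG, hxU⟩
      obtain ⟨i, hi⟩ := Set.mem_iUnion.1 hxU
      induction i using Fin.lastCases with
      | last => exact absurd ⟨x, hxG, hi⟩ hne
      | cast i =>
        obtain ⟨h1, j, h2⟩ := h x ⟨hxG, Set.mem_iUnion.2 ⟨i, hi⟩⟩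
        exact ⟨h1, _, h2⟩

/-- The iterated discretization `c k ∘ ⋯ ∘ c 1 ∘ c 0`. -/
def chain {X : Type*} (c : ℕ → X → X) : ℕ → X → X
  | 0 => c 0
  | k + 1 => c (k + 1) ∘ chain c k

lemma measurable_chain {X : Type*} [MeasurableSpace X] {c : ℕ → X → X}
    (hc : ∀ k, Measurable (c k)) (k : ℕ) : Measurable (chain c k) := by
  induction k with
  | zero => exact hc 0
  | succ k ih => exact (hc _).comp ih

lemma chain_mem {X : Type*} {c : ℕ → X → X} {G : Set X} {F : ℕ → Finset X} {T : ℕ}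
    (hFG : ∀ k ≤ T, (F k : Set X) ⊆ G) (hcF : ∀ k ≤ T, ∀ x ∈ G, c k x ∈ F k) {k : ℕ} (hk : k ≤ T)
    {x : X} (hx : x ∈ G) : chain c k x ∈ F k := by
  induction k with
  | zero => exact hcF 0 hk x hx
  | succ k ih => exact hcF _ hk _ (hFG k (by lia) (ih (by lia)))

/-- The cell of the points of `G` which `D` sends to `v`. -/
def cell {X : Type*} (G : Set X) (D : X → X) (v : X) : Set X := G ∩ D ⁻¹' {v}

lemma measurableSet_cell {X : Type*} [MeasurableSpace X] [MeasurableSingletonClass X] {G : Set X}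
    (hG : MeasurableSet G) {D : X → X} (hD : Measurable D) (v : X) :
    MeasurableSet (cell G D v) :=
  hG.inter (hD (measurableSet_singleton v))

lemma disjoint_cell {X : Type*} (G : Set X) (D : X → X) {v w : X} (h : v ≠ w) :
    Disjoint (cell G D v) (cell G D w) :=
  Set.disjoint_left.2 fun _ hx hy => h (hx.2.symm.trans hy.2)

/-- `∑ |p B - q B|` over the cells `B` of `D` with values in `F`. -/
noncomputable def cellDiff {X : Type*} [MeasurableSpace X] (G : Set X) (D : X → X) (F : Finset X)
    (p q : Measure X) : ℝ :=
  ∑ v ∈ F, |p.real (cell G D v) - q.real (cell G D v)|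

lemma setIntegral_comp_eq_sum {X : Type*} [MeasurableSpace X] [MeasurableSingletonClass X]
    {G : Set X} (hG : MeasurableSet G) {D : X → X} (hD : Measurable D) {F : Finset X}
    (hDF : ∀ x ∈ G, D x ∈ F) (h : X → ℝ) (p : Measure X) [IsFiniteMeasure p] :
    ∫ x in G, h (D x) ∂p = ∑ v ∈ F, p.real (cell G D v) * h v := by
  have hGU : G = ⋃ v ∈ F, cell G D v := by
    ext x
    simp only [cell, Set.mem_iUnion, Set.mem_inter_iff, Set.mem_preimage, Set.mem_singleton_iff,
      exists_prop]
    exact ⟨fun hx => ⟨D x, hDF x hx, hx, rfl⟩, fun ⟨_, _, hx, _⟩ => hx⟩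
  have hcong : ∀ v, Set.EqOn (fun x => h (D x)) (fun _ => h v) (cell G D v) := by
    intro v x hx
    have : D x = v := hx.2
    simp [this]
  conv_lhs => rw [hGU]
  rw [integral_biUnion_finset F (fun v _ => measurableSet_cell hG hD v)
    (fun v _ w _ hvw => disjoint_cell G D hvw)]
  · refine Finset.sum_congr rfl fun v _ => ?_
    rw [setIntegral_congr_fun (measurableSet_cell hG hD v) (hcong v)]
    simp
  · intro v _
    exact (integrableOn_congr_fun (hcong v) (measurableSet_cell hG hD v)).2 (by simp)

lemma abs_setIntegral_comp_sub_le {X : Type*} [MeasurableSpace X] [MeasurableSingletonClass X]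
    {G : Set X} (hG : MeasurableSet G) {D : X → X} (hD : Measurable D) {F : Finset X}
    (hDF : ∀ x ∈ G, D x ∈ F) {h : X → ℝ} {b : ℝ} (hb : ∀ v ∈ F, |h v| ≤ b)
    (p q : Measure X) [IsFiniteMeasure p] [IsFiniteMeasure q] :
    |∫ x in G, h (D x) ∂p - ∫ x in G, h (D x) ∂q| ≤ b * cellDiff G D F p q := by
  rw [setIntegral_comp_eq_sum hG hD hDF, setIntegral_comp_eq_sum hG hD hDF,
    ← Finset.sum_sub_distrib, cellDiff, Finset.mul_sum]
  refine (Finset.abs_sum_le_sum_abs _ _).trans (Finset.sum_le_sum fun v hv => ?_)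
  rw [← sub_mul, abs_mul, mul_comm]
  exact mul_le_mul_of_nonneg_right (hb v hv) (abs_nonneg _)

/-- Telescoping `f = (f - f ∘ E 0) + ∑ (f ∘ E k - f ∘ E (k + 1)) + f ∘ E T` on `G`, where
`E k` is the iterated discretization; off `G` the bound `|f| ≤ 1` is used. -/
lemma abs_integral_sub_le_chain {X : Type*} [MetricSpace X] [MeasurableSpace X] [BorelSpace X]
    {G : Set X} (hG : MeasurableSet G) {c : ℕ → X → X} (hc : ∀ k, Measurable (c k))
    {F : ℕ → Finset X} {T : ℕ} {r : ℕ → ℝ} (hr0 : 0 ≤ r 0)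
    (hFG : ∀ k ≤ T, (F k : Set X) ⊆ G) (hcF : ∀ k ≤ T, ∀ x ∈ G, c k x ∈ F k)
    (hr : ∀ k ≤ T, ∀ x ∈ G, dist x (c k x) ≤ r k)
    {f : X → ℝ} (hf1 : ∀ x, |f x| ≤ 1) (hfL : ∀ x y, |f x - f y| ≤ dist x y)
    (p q : Measure X) [IsProbabilityMeasure p] [IsProbabilityMeasure q] :
    |∫ x, f x ∂p - ∫ x, f x ∂q| ≤ p.real Gᶜ + q.real Gᶜ + 2 * r 0 +
      ∑ k ∈ Finset.range T, r (k + 1) * cellDiff G (chain c k) (F k) p q +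
      cellDiff G (chain c T) (F T) p q := by
  have hfm : Measurable f :=
    (LipschitzWith.of_dist_le_mul (K := 1) fun x y => by
      simpa [Real.dist_eq] using hfL x y).continuous.measurable
  have hEm := measurable_chain hc
  have hint : ∀ (μ : Measure X) [IsProbabilityMeasure μ] (D : X → X), Measurable D →
      Integrable (fun x => f (D x)) μ := fun μ _ D hD =>
    Integrable.of_bound (hfm.comp hD).aestronglyMeasurable 1 (ae_of_all _ fun x => hf1 _)
  -- the telescoping over the levels
  have key : ∀ k ≤ T, |∫ x in G, f (chain c 0 x) ∂p - ∫ x in G, f (chain c 0 x) ∂q| ≤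
      ∑ j ∈ Finset.range k, r (j + 1) * cellDiff G (chain c j) (F j) p q +
      |∫ x in G, f (chain c k x) ∂p - ∫ x in G, f (chain c k x) ∂q| := by
    intro k hk
    induction k with
    | zero => simp
    | succ k ih =>
      refine (ih (by lia)).trans ?_
      have h1 := abs_setIntegral_comp_sub_le hG (hEm k)
        (fun x hx => chain_mem hFG hcF (by lia : k ≤ T) hx)
        (h := fun v => f v - f (c (k + 1) v)) (b := r (k + 1))
        (fun v hv => (hfL _ _).trans (hr _ hk _ (hFG k (by lia) hv))) p q
      have h2 : ∀ (μ : Measure X) [IsProbabilityMeasure μ],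
          ∫ x in G, f (chain c k x) - f (c (k + 1) (chain c k x)) ∂μ =
          ∫ x in G, f (chain c k x) ∂μ - ∫ x in G, f (chain c (k + 1) x) ∂μ := fun μ _ =>
        integral_sub (hint μ _ (hEm k)).integrableOn (hint μ _ (hEm (k + 1))).integrableOn
      rw [h2 p, h2 q] at h1
      rw [Finset.sum_range_succ]
      generalize ∫ x in G, f (chain c k x) ∂p = a at *
      generalize ∫ x in G, f (chain c k x) ∂q = a' at *
      generalize ∫ x in G, f (chain c (k + 1) x) ∂p = b at *
      generalize ∫ x in G, f (chain c (k + 1) x) ∂q = b' at *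
      have h3 : a - a' = (a - b - (a' - b')) + (b - b') := by ring
      have := abs_add_le (a - b - (a' - b')) (b - b')
      rw [← h3] at this
      linarith
  have hlast := abs_setIntegral_comp_sub_le hG (hEm T)
    (fun x hx => chain_mem hFG hcF le_rfl hx) (h := f) (fun v _ => hf1 v) p q
  have hsplit : ∀ (μ : Measure X) [IsProbabilityMeasure μ],
      |∫ x, f x ∂μ - ∫ x in G, f (chain c 0 x) ∂μ| ≤ μ.real Gᶜ + r 0 := by
    intro μ _
    have hi : Integrable f μ := hint μ id measurable_id
    have h1 : ∫ x, f x ∂μ = ∫ x in G, f x ∂μ + ∫ x in Gᶜ, f x ∂μ :=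
      (integral_add_compl hG hi).symm
    have h2 : |∫ x in Gᶜ, f x ∂μ| ≤ μ.real Gᶜ := by
      simpa using norm_setIntegral_le_of_norm_le_const (μ := μ) (s := Gᶜ) (f := f) (C := 1)
        (by simp) (fun x _ => hf1 x)
    have h3 : |∫ x in G, f x ∂μ - ∫ x in G, f (chain c 0 x) ∂μ| ≤ r 0 * μ.real G := by
      rw [← integral_sub hi.integrableOn (hint μ _ (hEm 0)).integrableOn]
      exact norm_setIntegral_le_of_norm_le_const (μ := μ) (f := fun x => f x - f (chain c 0 x))
        (measure_lt_top _ _) (fun x hx => (hfL _ _).trans (hr 0 (by lia) x hx))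
    have h4 : r 0 * μ.real G ≤ r 0 := mul_le_of_le_one_right hr0 measureReal_le_one
    rw [h1]
    generalize ∫ x in G, f x ∂μ = a at *
    generalize ∫ x in Gᶜ, f x ∂μ = b at *
    generalize ∫ x in G, f (chain c 0 x) ∂μ = d at *
    have : a + b - d = (a - d) + b := by ring
    rw [this]
    exact (abs_add_le _ _).trans (by linarith)
  have hp := hsplit p
  have hq := hsplit q
  rw [one_mul] at hlast
  have hk := (key T le_rfl).trans (add_le_add le_rfl hlast)
  rw [abs_le] at *
  constructor <;> linarith [hp.1, hq.1, hk.1, hp.2, hq.2, hk.2]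

/-! ### Empirical measures of finite samples -/

/-- The empirical distribution of a finite nonempty sample. -/
noncomputable def empiricalOf {X ι : Type*} [MeasurableSpace X] [Fintype ι] [Nonempty ι]
    (y : ι → X) : ProbabilityMeasure X :=
  ⟨(Fintype.card ι : ℝ≥0∞)⁻¹ • ∑ i, Measure.dirac (y i), ⟨by
    simpa using ENNReal.inv_mul_cancel (Nat.cast_ne_zero.2 (Fintype.card_ne_zero (α := ι)))
      (ENNReal.natCast_ne_top _)⟩⟩

section

variable {X ι : Type*} [MeasurableSpace X] [Fintype ι] [Nonempty ι]

lemma coe_empiricalOf (y : ι → X) : (empiricalOf y : Measure X) =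
    (Fintype.card ι : ℝ≥0∞)⁻¹ • ∑ i, Measure.dirac (y i) := rfl

lemma measurable_empiricalOf : Measurable (empiricalOf : (ι → X) → ProbabilityMeasure X) := by
  refine Measurable.subtype_mk (Measure.measurable_of_measurable_coe _ fun s hs => ?_)
  simp only [Measure.smul_apply, Measure.finsetSum_apply, Measure.dirac_apply' _ hs, smul_eq_mul]
  refine Measurable.const_mul (Finset.measurable_sum _ fun i _ => ?_) _
  exact (measurable_one.indicator hs).comp (measurable_pi_apply i)

lemma integral_empiricalOf [MeasurableSingletonClass X] (y : ι → X) (f : X → ℝ) :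
    ∫ x, f x ∂(empiricalOf y : Measure X) = (Fintype.card ι : ℝ)⁻¹ * ∑ i, f (y i) := by
  rw [coe_empiricalOf, integral_smul_measure, integral_finsetSum_measure]
  · simp
  · exact fun i _ => integrable_dirac (by simp)

lemma real_empiricalOf [MeasurableSingletonClass X] (y : ι → X) {B : Set X}
    (hB : MeasurableSet B) : (empiricalOf y : Measure X).real B =
      ∑ i, (Fintype.card ι : ℝ)⁻¹ * B.indicator 1 (y i) := by
  rw [← integral_indicator_one hB, integral_empiricalOf, Finset.mul_sum]

lemma measurable_real_empiricalOf {B : Set X} (hB : MeasurableSet B) :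
    Measurable fun y : ι → X => (empiricalOf y : Measure X).real B :=
  ((Measure.measurable_coe hB).comp
    (measurable_subtype_coe.comp measurable_empiricalOf)).ennreal_toReal

lemma integral_real_empiricalOf [MeasurableSingletonClass X] (p : Measure X)
    [IsProbabilityMeasure p] {B : Set X} (hB : MeasurableSet B) :
    ∫ y, (empiricalOf y : Measure X).real B ∂(Measure.pi fun _ : ι => p) = p.real B := by
  have hind : Integrable (B.indicator (1 : X → ℝ)) p := (integrable_const 1).indicator hB
  simp_rw [real_empiricalOf _ hB]
  rw [integral_finsetSum]
  · have : ∀ i : ι, ∫ y : ι → X, (Fintype.card ι : ℝ)⁻¹ * B.indicator 1 (y i)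
        ∂(Measure.pi fun _ : ι => p) = (Fintype.card ι : ℝ)⁻¹ * p.real B := fun i => by
      rw [integral_const_mul, integral_comp_eval (μ := fun _ : ι => p) (i := i)
        (f := B.indicator (1 : X → ℝ)) hind.aestronglyMeasurable, integral_indicator_one hB]
    simp [this, Fintype.card_ne_zero]
  · exact fun i _ => (integrable_comp_eval (μ := fun _ : ι => p) (i := i) hind).const_mul _

lemma integral_sq_real_empiricalOf_sub_le [MeasurableSingletonClass X] (p : Measure X)
    [IsProbabilityMeasure p] {B : Set X} (hB : MeasurableSet B) :
    ∫ y, ((empiricalOf y : Measure X).real B - p.real B) ^ 2 ∂(Measure.pi fun _ : ι => p) ≤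
      p.real B / Fintype.card ι := by
  have hc : (Fintype.card ι : ℝ) ≠ 0 := by simp [Fintype.card_ne_zero]
  set g : X → ℝ := fun x => (Fintype.card ι : ℝ)⁻¹ * B.indicator 1 x with hg
  have hgm : Measurable g := (measurable_one.indicator hB).const_mul _
  have hgL : MemLp g 2 p := by
    refine MemLp.of_bound hgm.aestronglyMeasurable (Fintype.card ι : ℝ)⁻¹ (ae_of_all _ fun x => ?_)
    by_cases hx : x ∈ B <;> simp [hg, hx]
  have hsum : (fun y : ι → X => (empiricalOf y : Measure X).real B) =
      ∑ i : ι, fun y : ι → X => g (y i) := by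
    ext y
    rw [real_empiricalOf _ hB, Finset.sum_apply]
  have hvar : Var[g; p] ≤ p.real B / (Fintype.card ι) ^ 2 := by
    refine (variance_le_expectation_sq hgm.aestronglyMeasurable).trans_eq ?_
    have : (g ^ 2 : X → ℝ) = fun x => ((Fintype.card ι : ℝ) ^ 2)⁻¹ * B.indicator 1 x := by
      ext x
      by_cases hx : x ∈ B <;> simp [hg, hx]
    rw [this, integral_const_mul, integral_indicator_one hB]
    ring
  have hm := measurable_real_empiricalOf (ι := ι) hB
  have := variance_eq_integral (μ := Measure.pi fun _ : ι => p) hm.aemeasurable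
  rw [integral_real_empiricalOf p hB] at this
  rw [← this, hsum, variance_sum_pi fun _ => hgL]
  refine (Finset.sum_le_sum fun _ _ => hvar).trans_eq ?_
  simp only [Finset.sum_const, Finset.card_univ, nsmul_eq_mul]
  field_simp

lemma cellDiff_le_card {G : Set X} {D : X → X} {F : Finset X} (p q : Measure X)
    [IsProbabilityMeasure p] [IsProbabilityMeasure q] : |cellDiff G D F p q| ≤ F.card := by
  rw [cellDiff, abs_of_nonneg (Finset.sum_nonneg fun _ _ => abs_nonneg _)]
  refine (Finset.sum_le_card_nsmul F _ 1 fun v _ => abs_le.2 ⟨?_, ?_⟩).trans (by simp)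
  · have := measureReal_le_one (μ := q) (s := cell G D v)
    have := measureReal_nonneg (μ := p) (s := cell G D v)
    linarith
  · have := measureReal_le_one (μ := p) (s := cell G D v)
    have := measureReal_nonneg (μ := q) (s := cell G D v)
    linarith

lemma integrable_cellDiff [MeasurableSingletonClass X] {G : Set X} (hG : MeasurableSet G)
    {D : X → X} (hD : Measurable D) (F : Finset X) (p : Measure X) [IsProbabilityMeasure p] :
    Integrable (fun y : ι → X => cellDiff G D F p (empiricalOf y)) (Measure.pi fun _ : ι => p) := by
  refine Integrable.of_bound (Measurable.aestronglyMeasurable ?_) F.card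
    (ae_of_all _ fun y => cellDiff_le_card _ _)
  refine Finset.measurable_sum _ fun v _ => ?_
  exact continuous_abs.measurable.comp
    (measurable_const.sub (measurable_real_empiricalOf (measurableSet_cell hG hD v)))

/-- The mean total deviation of the empirical measure over `n` disjoint cells is at most
`√(n / m)`, by the Cauchy-Schwarz inequality and the variance of binomial frequencies. -/
lemma integral_cellDiff_le [MeasurableSingletonClass X] {G : Set X} (hG : MeasurableSet G)
    {D : X → X} (hD : Measurable D) (F : Finset X) (p : Measure X) [IsProbabilityMeasure p] :
    ∫ y : ι → X, cellDiff G D F p (empiricalOf y) ∂(Measure.pi fun _ : ι => p) ≤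
      √(F.card / Fintype.card ι) := by
  set μ := Measure.pi fun _ : ι => p
  have hB := measurableSet_cell hG hD
  have hi := integrable_cellDiff (ι := ι) hG hD F p
  have hL : MemLp (fun y : ι → X => cellDiff G D F p (empiricalOf y)) 2 μ :=
    MemLp.of_bound hi.aestronglyMeasurable F.card (ae_of_all _ fun y => cellDiff_le_card _ _)
  have hd : ∀ v, Integrable (fun y : ι → X =>
      ((empiricalOf y : Measure X).real (cell G D v) - p.real (cell G D v)) ^ 2) μ := by
    intro v
    have hm := (measurable_real_empiricalOf (ι := ι) (hB v)).sub_const (p.real (cell G D v))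
    refine Integrable.of_bound (hm.pow_const 2).aestronglyMeasurable 1 (ae_of_all _ fun y => ?_)
    rw [Real.norm_eq_abs, abs_of_nonneg (sq_nonneg _), sq_le_one_iff_abs_le_one, abs_le]
    have h1 := measureReal_le_one (μ := p) (s := cell G D v)
    have h2 := measureReal_nonneg (μ := p) (s := cell G D v)
    have h3 := measureReal_le_one (μ := (empiricalOf y : Measure X)) (s := cell G D v)
    have h4 := measureReal_nonneg (μ := (empiricalOf y : Measure X)) (s := cell G D v)
    constructor <;> linarith
  refine Real.le_sqrt_of_sq_le ?_
  have hjensen : (∫ y, cellDiff G D F p (empiricalOf y) ∂μ) ^ 2 ≤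
      ∫ y, cellDiff G D F p (empiricalOf y) ^ 2 ∂μ := by
    have h := variance_nonneg (fun y : ι → X => cellDiff G D F p (empiricalOf y)) μ
    rw [variance_eq_sub hL] at h
    simpa using h
  refine hjensen.trans ?_
  have hcs : ∀ y : ι → X, cellDiff G D F p (empiricalOf y) ^ 2 ≤ F.card * ∑ v ∈ F,
      ((empiricalOf y : Measure X).real (cell G D v) - p.real (cell G D v)) ^ 2 := by
    intro y
    refine (sq_sum_le_card_mul_sum_sq (s := F)).trans_eq ?_
    simp only [sq_abs]
    congr 1
    exact Finset.sum_congr rfl fun v _ => by ring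
  calc ∫ y, cellDiff G D F p (empiricalOf y) ^ 2 ∂μ
      ≤ ∫ y, F.card * ∑ v ∈ F,
          ((empiricalOf y : Measure X).real (cell G D v) - p.real (cell G D v)) ^ 2 ∂μ :=
        integral_mono hL.integrable_sq ((integrable_finsetSum _ fun v _ => hd v).const_mul _) hcs
    _ = F.card * ∑ v ∈ F, ∫ y,
          ((empiricalOf y : Measure X).real (cell G D v) - p.real (cell G D v)) ^ 2 ∂μ := by
        rw [integral_const_mul, integral_finsetSum _ fun v _ => hd v]
    _ ≤ F.card * ∑ v ∈ F, p.real (cell G D v) / Fintype.card ι := by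
        gcongr with v
        exact integral_sq_real_empiricalOf_sub_le p (hB v)
    _ ≤ F.card * (1 / Fintype.card ι) := by
        rw [← Finset.sum_div]
        gcongr
        rw [← measureReal_biUnion_finset (fun v _ w _ hvw => disjoint_cell G D hvw)
          (fun v _ => hB v)]
        exact measureReal_le_one
    _ = F.card / Fintype.card ι := by ring

end

/-! ### Mean bounded Lipschitz distance to the empirical measure -/

lemma bounded_lipschitz_of_blNorm_le_one {X : Type*} [MetricSpace X] {f : X → ℝ}
    (hf : blNorm f ≤ 1) : (∀ x, |f x| ≤ 1) ∧ ∀ x y, |f x - f y| ≤ dist x y := by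
  rw [blNorm] at hf
  have h1 : ∀ x, ‖f x‖ₑ ≤ 1 := fun x => (le_iSup _ x).trans (le_self_add.trans hf)
  have h2 : ∀ x y, edist (f x) (f y) / edist x y ≤ 1 := fun x y =>
    (le_iSup₂ (f := fun x y => edist (f x) (f y) / edist x y) x y).trans (le_add_self.trans hf)
  refine ⟨fun x => ?_, fun x y => ?_⟩
  · have := h1 x
    rw [← ofReal_norm, ENNReal.ofReal_le_one] at this
    exact this
  · rcases eq_or_ne x y with rfl | hxy
    · simp
    · have := h2 x y
      rw [ENNReal.div_le_iff (edist_pos.2 hxy).ne' (edist_ne_top _ _), one_mul, edist_dist,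
        edist_dist, ENNReal.ofReal_le_ofReal_iff dist_nonneg] at this
      exact this

/-- A finite covering number is attained, and the covering sets may be taken closed. -/
lemma exists_isClosed_cover_of_coverNumber_le {X : Type*} [MetricSpace X] [MeasurableSpace X]
    {ε η b : ℝ} {p : ProbabilityMeasure X} (hb : 0 ≤ b)
    (h : (coverNumber ε η p : ℝ≥0∞) ≤ ENNReal.ofReal b) :
    ∃ (n : ℕ) (U : Fin n → Set X), (n : ℝ) ≤ b ∧ (∀ i, IsClosed (U i)) ∧
      (∀ i, Metric.ediam (U i) ≤ ENNReal.ofReal (2 * ε)) ∧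
      (p : Measure X) (⋃ i, U i)ᶜ ≤ ENNReal.ofReal η := by
  classical
  by_cases hne : ∃ m : ℕ, ∃ U : Fin m → Set X,
      (∀ i, Metric.ediam (U i) ≤ ENNReal.ofReal (2 * ε)) ∧
        (p : Measure X) (⋃ i, U i)ᶜ ≤ ENNReal.ofReal η
  · obtain ⟨U, hU, hp⟩ := Nat.find_spec hne
    have hle : ((Nat.find hne : ℕ) : ℕ∞) ≤ coverNumber ε η p :=
      le_iInf₂ fun m hm => by exact_mod_cast Nat.find_min' hne hm
    refine ⟨Nat.find hne, fun i => closure (U i), ?_, fun i => isClosed_closure,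
      fun i => (Metric.ediam_closure _).trans_le (hU i), (measure_mono ?_).trans hp⟩
    · have h3 : ((Nat.find hne : ℕ) : ℝ≥0∞) ≤ ENNReal.ofReal b :=
        le_trans (by exact_mod_cast ENat.toENNReal_le.2 hle) h
      rwa [← ENNReal.ofReal_natCast, ENNReal.ofReal_le_ofReal_iff hb] at h3
    · exact Set.compl_subset_compl.2 (Set.iUnion_mono fun i => subset_closure)
  · have : coverNumber ε η p = ⊤ := by
      rw [coverNumber]
      exact iInf₂_eq_top.2 fun m hm => absurd ⟨m, hm⟩ hne
    simp [this] at h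

section

variable {X ι : Type*} [MetricSpace X] [MeasurableSpace X] [BorelSpace X] [Fintype ι] [Nonempty ι]

lemma lintegral_blDist_empiricalOf_le_chain (p : ProbabilityMeasure X)
    {G : Set X} (hG : MeasurableSet G) {c : ℕ → X → X} (hc : ∀ k, Measurable (c k))
    {F : ℕ → Finset X} {T : ℕ} {r : ℕ → ℝ}
    (hFG : ∀ k ≤ T, (F k : Set X) ⊆ G) (hcF : ∀ k ≤ T, ∀ x ∈ G, c k x ∈ F k)
    (hr : ∀ k ≤ T, ∀ x ∈ G, dist x (c k x) ≤ r k) (hrn : ∀ k, 0 ≤ r k) :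
    ∫⁻ y : ι → X, blDist p (empiricalOf y) ∂(Measure.pi fun _ => (p : Measure X)) ≤
      ENNReal.ofReal (2 * (p : Measure X).real Gᶜ + 2 * r 0 +
        ∑ k ∈ Finset.range T, r (k + 1) * √((F k).card / Fintype.card ι) +
        √((F T).card / Fintype.card ι)) := by
  set μ := Measure.pi fun _ : ι => (p : Measure X)
  set q := (p : Measure X)
  have hEm := measurable_chain hc
  have hiG : Integrable (fun y : ι → X => (empiricalOf y : Measure X).real Gᶜ) μ :=
    Integrable.of_bound (measurable_real_empiricalOf hG.compl).aestronglyMeasurable 1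
      (ae_of_all _ fun y => by
        rw [Real.norm_eq_abs, abs_of_nonneg measureReal_nonneg]
        exact measureReal_le_one)
  have hid : ∀ k, Integrable
      (fun y : ι → X => cellDiff G (chain c k) (F k) q (empiricalOf y)) μ := fun k =>
    integrable_cellDiff hG (hEm k) _ _
  set Z : (ι → X) → ℝ := fun y => q.real Gᶜ + (empiricalOf y : Measure X).real Gᶜ + 2 * r 0 +
      ∑ k ∈ Finset.range T, r (k + 1) * cellDiff G (chain c k) (F k) q (empiricalOf y) +
      cellDiff G (chain c T) (F T) q (empiricalOf y) with hZ
  have hcd : ∀ k (y : ι → X), 0 ≤ cellDiff G (chain c k) (F k) q (empiricalOf y) := fun k y =>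
    Finset.sum_nonneg fun _ _ => abs_nonneg _
  have hZ0 : ∀ y, 0 ≤ Z y := fun y => by
    have := Finset.sum_nonneg fun k (_ : k ∈ Finset.range T) => mul_nonneg (hrn (k + 1)) (hcd k y)
    have := hcd T y
    have : 0 ≤ q.real Gᶜ := measureReal_nonneg
    have : 0 ≤ (empiricalOf y : Measure X).real Gᶜ := measureReal_nonneg
    have := hrn 0
    simp only [hZ]
    positivity
  have hi0 : Integrable (fun y : ι → X => q.real Gᶜ + (empiricalOf y : Measure X).real Gᶜ) μ :=
    (integrable_const _).add hiG
  have hi1 : Integrable (fun y : ι → X => q.real Gᶜ + (empiricalOf y : Measure X).real Gᶜ +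
      2 * r 0) μ := hi0.add (integrable_const _)
  have hi2 : Integrable (fun y : ι → X => ∑ k ∈ Finset.range T,
      r (k + 1) * cellDiff G (chain c k) (F k) q (empiricalOf y)) μ :=
    integrable_finsetSum _ fun k _ => (hid k).const_mul _
  have hZi : Integrable Z μ := (hi1.add hi2).add (hid T)
  calc ∫⁻ y : ι → X, blDist p (empiricalOf y) ∂μ
      ≤ ∫⁻ y, ENNReal.ofReal (Z y) ∂μ := by
        refine lintegral_mono fun y => iSup₂_le fun f hf => ENNReal.ofReal_le_ofReal ?_
        obtain ⟨hf1, hfL⟩ := bounded_lipschitz_of_blNorm_le_one hf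
        exact (le_abs_self _).trans
          (abs_integral_sub_le_chain hG hc (hrn 0) hFG hcF hr hf1 hfL _ _)
    _ = ENNReal.ofReal (∫ y, Z y ∂μ) :=
        (ofReal_integral_eq_lintegral_ofReal hZi (ae_of_all _ hZ0)).symm
    _ ≤ _ := by
        refine ENNReal.ofReal_le_ofReal ?_
        have e1 : ∫ y, Z y ∂μ = (q.real Gᶜ + q.real Gᶜ + 2 * r 0) + ∑ k ∈ Finset.range T,
            r (k + 1) * ∫ y, cellDiff G (chain c k) (F k) q (empiricalOf y) ∂μ +
            ∫ y, cellDiff G (chain c T) (F T) q (empiricalOf y) ∂μ := by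
          have s1 : ∫ y, Z y ∂μ = _ := integral_add (hi1.add hi2) (hid T)
          have s2 := integral_add hi1 hi2
          have s3 : ∫ y : ι → X, (q.real Gᶜ + (empiricalOf y : Measure X).real Gᶜ + 2 * r 0) ∂μ =
              q.real Gᶜ + q.real Gᶜ + 2 * r 0 := by
            rw [integral_add hi0 (integrable_const _),
              integral_add (integrable_const _) hiG, integral_real_empiricalOf _ hG.compl,
              integral_const, integral_const, probReal_univ, one_smul, one_smul]
          rw [s1, s2, s3, integral_finsetSum _ fun k _ => (hid k).const_mul _]
          simp only [integral_const_mul]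
        rw [e1]
        have h1 : ∀ k, ∫ y, cellDiff G (chain c k) (F k) q (empiricalOf y) ∂μ ≤
            √((F k).card / Fintype.card ι) := fun k => integral_cellDiff_le hG (hEm k) _ _
        have h2 : ∑ k ∈ Finset.range T,
            r (k + 1) * ∫ y, cellDiff G (chain c k) (F k) q (empiricalOf y) ∂μ ≤
            ∑ k ∈ Finset.range T, r (k + 1) * √((F k).card / Fintype.card ι) :=
          Finset.sum_le_sum fun k _ => mul_le_mul_of_nonneg_left (h1 k) (hrn _)
        linarith [h1 T]

/-- The chaining bound in terms of covering numbers at the scales `ε 0, …, ε T`: the exceptional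
sets of all scales are removed together, which leaves a set covered at every scale. -/
lemma lintegral_blDist_empiricalOf_le_cover (p : ProbabilityMeasure X) {ε η b : ℕ → ℝ} {T : ℕ}
    (hε : ∀ k, 0 ≤ ε k) (hη : ∀ k, 0 ≤ η k) (hb : ∀ k, 0 ≤ b k)
    (h : ∀ k ≤ T, (coverNumber (ε k) (η k) p : ℝ≥0∞) ≤ ENNReal.ofReal (b k)) :
    ∫⁻ y : ι → X, blDist p (empiricalOf y) ∂(Measure.pi fun _ => (p : Measure X)) ≤
      ENNReal.ofReal (2 * ∑ k ∈ Finset.range (T + 1), η k + 4 * ε 0 +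
        ∑ k ∈ Finset.range T, 2 * ε (k + 1) * √(b k / Fintype.card ι) +
        √(b T / Fintype.card ι)) := by
  have : Nonempty X := by
    by_contra hX
    have := not_nonempty_iff.1 hX
    have h1 := measure_univ (μ := (p : Measure X))
    simp [Set.univ_eq_empty_iff.2 this] at h1
  have h' : ∀ k, ∃ (n : ℕ) (U : Fin n → Set X), k ≤ T → (n : ℝ) ≤ b k ∧ (∀ i, IsClosed (U i)) ∧
      (∀ i, Metric.ediam (U i) ≤ ENNReal.ofReal (2 * ε k)) ∧
      (p : Measure X) (⋃ i, U i)ᶜ ≤ ENNReal.ofReal (η k) := by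
    intro k
    by_cases hk : k ≤ T
    · obtain ⟨n, U, hU⟩ := exists_isClosed_cover_of_coverNumber_le (hb k) (h k hk)
      exact ⟨n, U, fun _ => hU⟩
    · exact ⟨0, fun _ => ∅, fun h => absurd h hk⟩
  choose n U hU using h'
  set G : Set X := ⋂ k ∈ Finset.range (T + 1), ⋃ i, U k i with hGdef
  have hG : MeasurableSet G := Finset.measurableSet_biInter _ fun k hk =>
    MeasurableSet.iUnion fun i => ((hU k (by simpa [Nat.lt_succ_iff] using hk)).2.1 i).measurableSet
  have hGU : ∀ k ≤ T, G ⊆ ⋃ i, U k i := fun k hk =>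
    Set.biInter_subset_of_mem (by simpa [Nat.lt_succ_iff] using hk)
  have hpG : (p : Measure X).real Gᶜ ≤ ∑ k ∈ Finset.range (T + 1), η k := by
    rw [hGdef, Set.compl_iInter₂]
    refine (measureReal_biUnion_finset_le _ _).trans (Finset.sum_le_sum fun k hk => ?_)
    exact ENNReal.toReal_le_of_le_ofReal (hη k)
      (hU k (by simpa [Nat.lt_succ_iff] using hk)).2.2.2
  have hsel : ∀ k, ∃ (c : X → X) (F : Finset X), Measurable c ∧ (k ≤ T → F.card ≤ n k ∧
      (F : Set X) ⊆ G ∧ ∀ x ∈ G, c x ∈ F ∧ ∃ i, x ∈ U k i ∧ c x ∈ U k i) := by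
    intro k
    by_cases hk : k ≤ T
    · obtain ⟨c, F, hc, h1, h2, h3⟩ := exists_measurable_selector G (n k) (U k)
        fun i => ((hU k hk).2.1 i).measurableSet
      exact ⟨c, F, hc, fun _ => ⟨h1, h2, fun x hx => h3 x ⟨hx, hGU k hk hx⟩⟩⟩
    · exact ⟨id, ∅, measurable_id, fun h => absurd h hk⟩
  choose c F hc hF using hsel
  refine (lintegral_blDist_empiricalOf_le_chain p hG hc (r := fun k => 2 * ε k) (T := T) (F := F)
    (fun k hk => (hF k hk).2.1) (fun k hk x hx => ((hF k hk).2.2 x hx).1)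
    (fun k hk x hx => ?_) fun k => by simpa using hε k).trans (ENNReal.ofReal_le_ofReal ?_)
  · obtain ⟨i, hi1, hi2⟩ := ((hF k hk).2.2 x hx).2
    have := (Metric.edist_le_ediam_of_mem hi1 hi2).trans ((hU k hk).2.2.1 i)
    rwa [edist_dist, ENNReal.ofReal_le_ofReal_iff (by simpa using hε k)] at this
  · have hs : ∀ k ≤ T, √((F k).card / Fintype.card ι) ≤ √(b k / Fintype.card ι) := fun k hk => by
      gcongr
      exact (Nat.cast_le.2 (hF k hk).1).trans (hU k hk).1
    have h2 : ∑ k ∈ Finset.range T, 2 * ε (k + 1) * √((F k).card / Fintype.card ι) ≤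
        ∑ k ∈ Finset.range T, 2 * ε (k + 1) * √(b k / Fintype.card ι) :=
      Finset.sum_le_sum fun k hk => mul_le_mul_of_nonneg_left
        (hs k (Finset.mem_range.1 hk).le) (by simpa using hε _)
    linarith [hs T le_rfl]

end

/-- A power of `B` within a factor `B` above `x`, the least one above `x`. -/
lemma exists_least_pow_ge {B x : ℝ} (hB : 1 < B) (hx : 1 ≤ x) :
    ∃ n : ℕ, x ≤ B ^ n ∧ B ^ n ≤ B * x ∧ ∀ l : ℕ, x ≤ B ^ l → n ≤ l := by
  classical
  have hex : ∃ n : ℕ, x ≤ B ^ n := (pow_unbounded_of_one_lt x hB).imp fun _ h => h.le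
  refine ⟨Nat.find hex, Nat.find_spec hex, ?_, fun l hl => Nat.find_min' hex hl⟩
  rcases h : Nat.find hex with _ | n
  · rw [pow_zero]
    nlinarith
  · have := Nat.find_min hex (m := n) (by lia)
    rw [pow_succ']
    gcongr
    exact (not_le.1 this).le

lemma sum_range_succ_le_two_mul {η : ℕ → ℝ} (h0 : ∀ k, 0 ≤ η k) (h : ∀ k, 3 * η k ≤ η (k + 1))
    (T : ℕ) : ∑ k ∈ Finset.range (T + 1), η k ≤ 2 * η T := by
  induction T with
  | zero =>
    have := h0 0
    simp only [zero_add, Finset.sum_range_one]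
    linarith
  | succ T ih =>
    rw [Finset.sum_range_succ]
    linarith [h T, h0 T]

lemma coverNumber_le_ofReal {X : Type*} [MetricSpace X] [MeasurableSpace X] {k : ℕ}
    {p : ProbabilityMeasure X} (hp : Psi k p ≠ ∞) {ε : ℝ} (hε : ε ∈ Set.Ioc (0 : ℝ) 1) :
    (coverNumber ε (ε ^ ((k : ℝ) / ((k : ℝ) - 2))) p : ℝ≥0∞) ≤
      ENNReal.ofReal ((Psi k p).toReal ^ 2 / ε ^ k) := by
  have hεk : 0 < ε ^ k := pow_pos hε.1 k
  have h1 : ENNReal.ofReal (ε ^ k) *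
      (coverNumber ε (ε ^ ((k : ℝ) / ((k : ℝ) - 2))) p : ℝ≥0∞) ≤ Psi k p ^ 2 := by
    rw [Psi, ← ENNReal.rpow_natCast, ← ENNReal.rpow_mul]
    rw [show (1 / 2 : ℝ) * ((2 : ℕ) : ℝ) = 1 by norm_num, ENNReal.rpow_one]
    exact le_iSup₂ (f := fun (ε : ℝ) (_ : ε ∈ Set.Ioc (0 : ℝ) 1) => ENNReal.ofReal (ε ^ k) *
      (coverNumber ε (ε ^ ((k : ℝ) / ((k : ℝ) - 2))) p : ℝ≥0∞)) ε hε
  rw [ENNReal.ofReal_div_of_pos hεk, ENNReal.ofReal_pow ENNReal.toReal_nonneg,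
    ENNReal.ofReal_toReal hp, ENNReal.le_div_iff_mul_le (by simp [hεk]) (by simp), mul_comm]
  exact h1

/-- `Ψ_k` is bounded below, because at the scale `ε = 1 / 3` at least one set is needed. -/
lemma one_le_toReal_Psi_mul {X : Type*} [MetricSpace X] [MeasurableSpace X] {k : ℕ} (hk : 2 < k)
    {p : ProbabilityMeasure X} (hp : Psi k p ≠ ∞) : 1 ≤ (Psi k p).toReal * √3 ^ k := by
  by_contra! hlt
  have hk' : (2 : ℝ) < k := by exact_mod_cast hk
  have h := coverNumber_le_ofReal hp (ε := 1 / 3) ⟨by norm_num, by norm_num⟩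
  obtain ⟨n, U, hn, -, -, hU⟩ := exists_isClosed_cover_of_coverNumber_le (by positivity) h
  have hb : (Psi k p).toReal ^ 2 / (1 / 3) ^ k < 1 := by
    have e : (Psi k p).toReal ^ 2 / (1 / 3) ^ k = ((Psi k p).toReal * √3 ^ k) ^ 2 := by
      rw [mul_pow, ← pow_mul, mul_comm k 2, pow_mul, Real.sq_sqrt (by norm_num)]
      simp
    rw [e]
    exact pow_lt_one₀ (by positivity) hlt (by norm_num)
  have hn0 : n = 0 := by
    have : (n : ℝ) < 1 := hn.trans_lt hb
    have : n < 1 := by exact_mod_cast this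
    lia
  subst hn0
  simp only [Set.iUnion_of_empty, Set.compl_empty, measure_univ] at hU
  rw [ENNReal.one_le_ofReal] at hU
  have : ((1 : ℝ) / 3) ^ ((k : ℝ) / (k - 2)) < 1 :=
    Real.rpow_lt_one (by norm_num) (by norm_num) (div_pos (by linarith) (by linarith))
  linarith

/-- Dudley's bound for the speed of convergence in the mean Glivenko-Cantelli theorem. With
`a = m ^ (1 / k)`, the chaining runs over the scales `3 ^ (-s), …, 3 ^ (-t)`, where
`3 ^ (-t) ≈ 1 / a` is the target precision, and where `3 ^ (-s) ≈ a ^ (-(k - 2) / k)` is the scale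
whose exceptional sets have mass about `1 / a`. -/
theorem lintegral_blDist_empiricalOf_le {X ι : Type*} [MetricSpace X] [MeasurableSpace X]
    [BorelSpace X] [Fintype ι] [Nonempty ι] (p : ProbabilityMeasure X) {k : ℕ} (hk : 2 < k) :
    ∫⁻ y : ι → X, blDist p (empiricalOf y) ∂(Measure.pi fun _ => (p : Measure X)) ≤
      (Fintype.card ι : ℝ≥0∞) ^ (-(1 / (k : ℝ))) * (3 ^ (2 * k) * Psi k p) := by
  have hm0 : 0 < Fintype.card ι := Fintype.card_pos
  by_cases hp : Psi k p = ∞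
  · rw [hp, ENNReal.mul_top (by simp), ENNReal.mul_top]
    · exact le_top
    · simp
  have hk' : (2 : ℝ) < k := by exact_mod_cast hk
  set m := Fintype.card ι
  have hm1 : (1 : ℝ) ≤ m := by exact_mod_cast hm0
  set K := (Psi k p).toReal with hK
  have hK0 : 0 ≤ K := ENNReal.toReal_nonneg
  set a : ℝ := (m : ℝ) ^ (1 / (k : ℝ)) with ha
  have ha1 : 1 ≤ a := Real.one_le_rpow hm1 (by positivity)
  have ha0 : 0 < a := by linarith
  have hak : a ^ k = m := by
    rw [ha, ← Real.rpow_natCast, ← Real.rpow_mul (by positivity)]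
    simp [show k ≠ 0 by lia]
  -- `σ ^ k` is the square root of the growth factor `3 ^ k` of the covering numbers per scale
  have hσ : √3 ^ 2 = (3 : ℝ) := Real.sq_sqrt (by norm_num)
  set σ : ℝ := √3
  have hσ0 : 0 < σ := Real.sqrt_pos.2 (by norm_num)
  have hσ1 : 3 / 2 ≤ σ := by nlinarith
  obtain ⟨d, rfl⟩ : ∃ d, k = d + 2 := ⟨k - 2, by lia⟩
  have hd : d ≠ 0 := by lia
  set k := d + 2
  -- `3 ^ (-t)` is the finest scale and `3 ^ (-s)` the coarsest one
  obtain ⟨t, ht1, ht2, -⟩ := exists_least_pow_ge (B := 3) (x := a) (by norm_num) ha1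
  obtain ⟨s, hs1, hs2, hsmin⟩ := exists_least_pow_ge (B := 3 ^ k) (x := a ^ d)
    (one_lt_pow₀ (by norm_num) (by lia)) (one_le_pow₀ ha1)
  have hst : s ≤ t := by
    refine hsmin t ?_
    rw [← pow_mul, mul_comm, pow_mul]
    exact (pow_le_pow_right₀ ha1 (by lia)).trans (pow_le_pow_left₀ ha0.le ht1 k)
  set T := t - s
  -- the scales are numbered from the finest to the coarsest
  set ε : ℕ → ℝ := fun j => 3 ^ j / 3 ^ t with hεdef
  have hε0 : ∀ j, 0 < ε j := fun j => by positivity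
  have hε1 : ∀ j ≤ T, ε j ≤ 1 := fun j hj =>
    (div_le_one (by positivity)).2 (pow_le_pow_right₀ (by norm_num) (by lia))
  have hεT : ε T = 1 / 3 ^ s := by
    have : t = T + s := by lia
    simp only [hεdef]
    rw [this, pow_add]
    field_simp
  set α : ℝ := (k : ℝ) / ((k : ℝ) - 2)
  have hα1 : 1 ≤ α := (one_le_div (by linarith)).2 (by linarith)
  have hmain := lintegral_blDist_empiricalOf_le_cover (ι := ι) p (ε := ε) (η := fun j => ε j ^ α)
    (b := fun j => K ^ 2 / ε j ^ k) (T := T) (fun j => (hε0 j).le)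
    (fun j => Real.rpow_nonneg (hε0 j).le _)
    (fun j => div_nonneg (sq_nonneg _) (pow_nonneg (hε0 j).le _))
    (fun j hj => coverNumber_le_ofReal hp ⟨hε0 j, hε1 j hj⟩)
  refine hmain.trans ?_
  -- the exceptional sets
  have hη : ∑ j ∈ Finset.range (T + 1), ε j ^ α ≤ 2 / a := by
    refine (sum_range_succ_le_two_mul (fun j => Real.rpow_nonneg (hε0 j).le _)
      (fun j => ?_) T).trans ?_
    · have : ε (j + 1) = 3 * ε j := by
        simp only [hεdef, pow_succ]
        ring
      rw [this, Real.mul_rpow (by norm_num) (hε0 j).le]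
      refine mul_le_mul_of_nonneg_right ?_ (Real.rpow_nonneg (hε0 j).le _)
      exact Real.self_le_rpow_of_one_le (by norm_num) hα1
    · have h1 : ε T ^ k ≤ (1 / a) ^ d := by
        rw [hεT, div_pow, div_pow, one_pow, one_pow, ← pow_mul, mul_comm, pow_mul]
        exact one_div_le_one_div_of_le (by positivity) hs1
      have h2 : ε T ^ α ≤ 1 / a := by
        have e : α = (k : ℕ) * (d : ℝ)⁻¹ := by
          simp only [α, k]
          push_cast
          ring_nf
        rw [e, Real.rpow_mul (hε0 T).le, Real.rpow_natCast]
        refine (Real.rpow_le_rpow (by have := hε0 T; positivity) h1 (by positivity)).trans_eq ?_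
        exact Real.pow_rpow_inv_natCast (by positivity) hd
      calc 2 * ε T ^ α ≤ 2 * (1 / a) := by gcongr
        _ = 2 / a := by ring
  have hε0a : ε 0 ≤ 1 / a := by
    simp only [hεdef, pow_zero]
    exact one_div_le_one_div_of_le ha0 ht1
  have hσk : (σ ^ k) ^ 2 = 3 ^ k := by rw [← pow_mul, mul_comm, pow_mul, hσ]
  -- the links of the chain
  have hsq : ∀ j, √(K ^ 2 / ε j ^ k / m) ≤ K * σ ^ k / (σ ^ j) ^ k := by
    intro j
    refine Real.sqrt_le_iff.2 ⟨by positivity, ?_⟩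
    have e : (K * σ ^ k / (σ ^ j) ^ k) ^ 2 = K ^ 2 * 3 ^ k / (3 ^ j) ^ k := by
      rw [div_pow, mul_pow, hσk, show ((σ ^ j) ^ k) ^ 2 = ((σ ^ 2) ^ j) ^ k by ring, hσ]
    have e2 : K ^ 2 / ε j ^ k / m = K ^ 2 * (3 ^ t) ^ k / ((3 ^ j) ^ k * a ^ k) := by
      simp only [hεdef]
      rw [← hak, div_pow]
      field_simp
    have h3 : ((3 : ℝ) ^ t) ^ k ≤ 3 ^ k * a ^ k := by
      rw [← mul_pow]
      exact pow_le_pow_left₀ (by positivity) ht2 k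
    rw [e, e2, div_le_div_iff₀ (by positivity) (by positivity)]
    calc K ^ 2 * (3 ^ t) ^ k * (3 ^ j) ^ k ≤ K ^ 2 * (3 ^ k * a ^ k) * (3 ^ j) ^ k := by gcongr
      _ = _ := by ring
  have hterm : ∀ j, 2 * ε (j + 1) * √(K ^ 2 / ε j ^ k / m) ≤
      6 * (K * σ ^ k) / a * (2 / 3) ^ j := by
    intro j
    have h1 : 2 * ε (j + 1) ≤ 6 * 3 ^ j / a := by
      have : 2 * ε (j + 1) = 6 * 3 ^ j / 3 ^ t := by
        simp only [hεdef, pow_succ]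
        ring
      rw [this]
      gcongr
    have h2 : (3 : ℝ) ^ j / (σ ^ j) ^ k ≤ (2 / 3) ^ j := by
      rw [← pow_mul, mul_comm, pow_mul, ← div_pow]
      refine pow_le_pow_left₀ (by positivity) ?_ j
      rw [div_le_iff₀ (by positivity)]
      have h3 : σ ^ 3 ≤ σ ^ k := pow_le_pow_right₀ (by linarith) hk
      have h4 : σ ^ 3 = 3 * σ := by rw [pow_succ, hσ]
      linarith
    calc 2 * ε (j + 1) * √(K ^ 2 / ε j ^ k / m)
        ≤ 6 * 3 ^ j / a * (K * σ ^ k / (σ ^ j) ^ k) := by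
          gcongr
          exact hsq j
      _ = 6 * (K * σ ^ k) / a * (3 ^ j / (σ ^ j) ^ k) := by ring
      _ ≤ _ := by gcongr
  have hsum : ∑ j ∈ Finset.range T, 2 * ε (j + 1) * √(K ^ 2 / ε j ^ k / m) ≤
      18 * (K * σ ^ k) / a := by
    refine (Finset.sum_le_sum fun j _ => hterm j).trans ?_
    rw [← Finset.mul_sum, geom_sum_eq (by norm_num)]
    have : ((2 / 3 : ℝ) ^ T - 1) / (2 / 3 - 1) ≤ 3 := by
      have : (0 : ℝ) ≤ (2 / 3) ^ T := by positivity
      rw [div_le_iff_of_neg (by norm_num)]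
      linarith
    calc _ ≤ 6 * (K * σ ^ k) / a * 3 := by gcongr
      _ = _ := by ring
  -- the coarsest scale
  have hlast : √(K ^ 2 / ε T ^ k / m) ≤ K * σ ^ k / a := by
    refine Real.sqrt_le_iff.2 ⟨by positivity, ?_⟩
    have e : (K * σ ^ k / a) ^ 2 = K ^ 2 * 3 ^ k / a ^ 2 := by rw [div_pow, mul_pow, hσk]
    rw [e, hεT, ← hak, div_pow, one_pow, div_div_eq_mul_div, div_one,
      div_le_div_iff₀ (by positivity) (by positivity)]
    have h3 : ((3 : ℝ) ^ s) ^ k ≤ 3 ^ k * a ^ d := by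
      rw [← pow_mul, mul_comm, pow_mul]
      exact hs2
    calc K ^ 2 * (3 ^ s) ^ k * a ^ 2 ≤ K ^ 2 * (3 ^ k * a ^ d) * a ^ 2 := by gcongr
      _ = K ^ 2 * 3 ^ k * a ^ k := by simp only [k, pow_add]; ring
  have hKσ : 1 ≤ K * σ ^ k := one_le_toReal_Psi_mul hk hp
  have htotal : 2 * ∑ j ∈ Finset.range (T + 1), ε j ^ α + 4 * ε 0 +
      ∑ j ∈ Finset.range T, 2 * ε (j + 1) * √(K ^ 2 / ε j ^ k / m) +
      √(K ^ 2 / ε T ^ k / m) ≤ a⁻¹ * (3 ^ (2 * k) * K) := by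
    have h1 : 2 * ∑ j ∈ Finset.range (T + 1), ε j ^ α + 4 * ε 0 +
        ∑ j ∈ Finset.range T, 2 * ε (j + 1) * √(K ^ 2 / ε j ^ k / m) +
        √(K ^ 2 / ε T ^ k / m) ≤ a⁻¹ * (8 + 19 * (K * σ ^ k)) := by
      refine (add_le_add (add_le_add (add_le_add (mul_le_mul_of_nonneg_left hη zero_le_two)
        (mul_le_mul_of_nonneg_left hε0a zero_le_four)) hsum) hlast).trans_eq ?_
      field_simp
      ring
    refine h1.trans (mul_le_mul_of_nonneg_left ?_ (by positivity))
    have h2 : (27 : ℝ) ≤ 3 ^ k := by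
      calc (27 : ℝ) = 3 ^ 3 := by norm_num
        _ ≤ 3 ^ k := pow_le_pow_right₀ (by norm_num) hk
    have h3 : σ ^ k ≤ 3 ^ k := pow_le_pow_left₀ hσ0.le (by nlinarith) k
    calc 8 + 19 * (K * σ ^ k) ≤ 27 * (K * σ ^ k) := by linarith
      _ ≤ 3 ^ k * (K * 3 ^ k) := by gcongr
      _ = 3 ^ (2 * k) * K := by rw [two_mul, pow_add]; ring
  refine (ENNReal.ofReal_le_ofReal htotal).trans_eq ?_
  rw [ENNReal.ofReal_mul (by positivity), ENNReal.ofReal_mul (by positivity), hK,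
    ENNReal.ofReal_toReal hp, ENNReal.ofReal_pow (by norm_num), ha,
    ← Real.rpow_neg (by positivity), ← ENNReal.ofReal_rpow_of_pos (by positivity)]
  simp

/-! ### Measurability of `Ψ_k` -/

lemma coverNumber_anti {X : Type*} [MetricSpace X] [MeasurableSpace X] {ε ε' η η' : ℝ} (hε : ε ≤ ε')
    (hη : η ≤ η') (p : ProbabilityMeasure X) :
    coverNumber ε' η' p ≤ coverNumber ε η p :=
  le_iInf₂ fun m ⟨U, hU, hp⟩ => iInf₂_le m
    ⟨U, fun i => (hU i).trans (ENNReal.ofReal_le_ofReal (by linarith)),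
      hp.trans (ENNReal.ofReal_le_ofReal hη)⟩

/-- Passage to the limit `x ↑ ε` in a bound on `x ^ k * c`. -/
lemma ofReal_pow_mul_le_of_forall_lt {ε : ℝ} (hε : 0 < ε) (k : ℕ) {c S : ℝ≥0∞}
    (h : ∀ x, 0 < x → x < ε → ENNReal.ofReal (x ^ k) * c ≤ S) : ENNReal.ofReal (ε ^ k) * c ≤ S := by
  have ht : Filter.Tendsto (fun x : ℝ => ENNReal.ofReal (x ^ k) * c) (nhdsWithin ε (Set.Iio ε))
      (nhds (ENNReal.ofReal (ε ^ k) * c)) := by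
    refine ENNReal.Tendsto.mul_const ?_ (Or.inl (by simpa using pow_pos hε k))
    exact (ENNReal.continuous_ofReal.comp (continuous_pow k)).continuousWithinAt
  refine le_of_tendsto ht ?_
  filter_upwards [Ioo_mem_nhdsLT hε] with x hx using h x hx.1 hx.2

section

variable {X : Type*} [MetricSpace X] [SecondCountableTopology X] [MeasurableSpace X]

/-- The probability measures whose mass up to strictly less than `η` is covered by `m` sets of
diameter strictly less than `2 ε`, each of them a finite union of sets of a fixed countable
basis. -/
def strictlyCovered (ε η : ℝ) (m : ℕ) : Set (ProbabilityMeasure X) :=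
  {p | ∃ V : Fin m → Finset (TopologicalSpace.countableBasis X),
    (∀ i, Metric.ediam (⋃ b ∈ V i, (b : Set X)) < ENNReal.ofReal (2 * ε)) ∧
      (p : Measure X) (⋃ i, ⋃ b ∈ V i, (b : Set X))ᶜ < ENNReal.ofReal η}

open scoped Classical in
/-- The covering number with strict inequalities and coverings by finite unions of sets of a
countable basis. Unlike `coverNumber`, it is an infimum over countably many coverings. -/
noncomputable def strictCoverNumber (ε η : ℝ) (p : ProbabilityMeasure X) : ℝ≥0∞ :=
  ⨅ m : ℕ, if p ∈ strictlyCovered ε η m then (m : ℝ≥0∞) else ⊤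

lemma coverNumber_le_strictCoverNumber (ε η : ℝ) (p : ProbabilityMeasure X) :
    (coverNumber ε η p : ℝ≥0∞) ≤ strictCoverNumber ε η p := by
  refine le_iInf fun m => ?_
  split_ifs with h
  · obtain ⟨V, hV, hp⟩ := h
    have : coverNumber ε η p ≤ (m : ℕ∞) := iInf₂_le m ⟨_, fun i => (hV i).le, hp.le⟩
    exact_mod_cast ENat.toENNReal_le.2 this
  · exact le_top

variable [BorelSpace X]

lemma measurable_strictCoverNumber (ε η : ℝ) :
    Measurable (strictCoverNumber ε η : ProbabilityMeasure X → ℝ≥0∞) := by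
  classical
  refine Measurable.iInf fun m => Measurable.ite ?_ measurable_const measurable_const
  have : strictlyCovered ε η m = ⋃ V : Fin m → Finset (TopologicalSpace.countableBasis X),
      {p : ProbabilityMeasure X |
        (∀ i, Metric.ediam (⋃ b ∈ V i, (b : Set X)) < ENNReal.ofReal (2 * ε)) ∧
        (p : Measure X) (⋃ i, ⋃ b ∈ V i, (b : Set X))ᶜ < ENNReal.ofReal η} := by
    ext p
    simp [strictlyCovered]
  rw [this]
  refine MeasurableSet.iUnion fun V => (MeasurableSet.const _).inter ?_
  have hm : MeasurableSet (⋃ i, ⋃ b ∈ V i, (b : Set X))ᶜ :=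
    (isOpen_iUnion fun i => isOpen_biUnion fun b _ =>
      TopologicalSpace.isOpen_of_mem_countableBasis b.2).measurableSet.compl
  exact measurableSet_lt ((Measure.measurable_coe hm).comp measurable_subtype_coe)
    measurable_const

/-- A covering can be made strict at slightly larger parameters: by inner regularity its sets may
be taken compact, and compact sets are enlarged slightly to finite unions of basic open sets. -/
lemma strictCoverNumber_le_coverNumber [CompleteSpace X] {ε ε' η η' : ℝ} (hε0 : 0 ≤ ε)
    (hε : ε < ε') (hη0 : 0 ≤ η) (hη : η < η') (p : ProbabilityMeasure X) :
    strictCoverNumber ε' η' p ≤ (coverNumber ε η p : ℝ≥0∞) := by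
  classical
  by_cases htop : coverNumber ε η p = ⊤
  · simp [htop]
  obtain ⟨n, hn⟩ := ENat.ne_top_iff_exists.1 htop
  obtain ⟨m, U, hmn, hUc, hU, hp⟩ := exists_isClosed_cover_of_coverNumber_le (b := n)
    n.cast_nonneg (show (coverNumber ε η p : ℝ≥0∞) ≤ _ by simp [← hn])
  have hmn' : m ≤ n := by exact_mod_cast hmn
  suffices h : p ∈ strictlyCovered ε' η' m by
    refine (iInf_le _ m).trans ?_
    rw [if_pos h, ← hn]
    simpa using hmn'
  have hηlt : ENNReal.ofReal η < ENNReal.ofReal η' :=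
    (ENNReal.ofReal_lt_ofReal_iff (hη0.trans_lt hη)).2 hη
  have hUm : MeasurableSet (⋃ i, U i) := MeasurableSet.iUnion fun i => (hUc i).measurableSet
  obtain ⟨K, hKU, hK, hKp⟩ := hUm.exists_isCompact_sdiff_lt (μ := (p : Measure X))
    (measure_ne_top _ _) (tsub_pos_of_lt hηlt).ne'
  set ρ : NNReal := ⟨(ε' - ε) / 2, by linarith⟩
  have hρ : (0 : ℝ) < ρ := by
    change 0 < (ε' - ε) / 2
    linarith
  have hV : ∀ i, ∃ V : Finset (TopologicalSpace.countableBasis X),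
      K ∩ U i ⊆ ⋃ b ∈ V, (b : Set X) ∧
      ⋃ b ∈ V, (b : Set X) ⊆ Metric.thickening ρ (K ∩ U i) := by
    intro i
    obtain ⟨b', hb', hfin, hcov⟩ := (hK.inter_right (hUc i)).elim_finite_subcover_image
      (b := {b : TopologicalSpace.countableBasis X | (b : Set X) ⊆ Metric.thickening ρ (K ∩ U i)})
      (c := fun b => (b : Set X))
      (fun b _ => TopologicalSpace.isOpen_of_mem_countableBasis b.2) (fun x hx => by
        obtain ⟨v, hv, hxv, hvs⟩ :=
          (TopologicalSpace.isBasis_countableBasis X).exists_subset_of_mem_open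
            (Metric.self_subset_thickening hρ _ hx) Metric.isOpen_thickening
        exact Set.mem_biUnion (x := ⟨v, hv⟩) hvs hxv)
    refine ⟨hfin.toFinset, by simpa using hcov, ?_⟩
    exact Set.iUnion₂_subset fun b hb => hb' (hfin.mem_toFinset.1 hb)
  choose V hV1 hV2 using hV
  refine ⟨V, fun i => ?_, ?_⟩
  · refine ((Metric.ediam_mono (hV2 i)).trans (Metric.ediam_thickening_le ρ)).trans_lt ?_
    have h1 : Metric.ediam (K ∩ U i) ≤ ENNReal.ofReal (2 * ε) :=
      (Metric.ediam_mono Set.inter_subset_right).trans (hU i)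
    refine (add_le_add_left h1 _).trans_lt ?_
    have h2 : 2 * (ρ : ℝ≥0∞) = ENNReal.ofReal (ε' - ε) := by
      rw [← ENNReal.ofReal_coe_nnreal, show (2 : ℝ≥0∞) = ENNReal.ofReal 2 by simp,
        ← ENNReal.ofReal_mul (by norm_num)]
      congr 1
      change 2 * ((ε' - ε) / 2) = _
      ring
    rw [h2, ← ENNReal.ofReal_add (by linarith) (by linarith),
      ENNReal.ofReal_lt_ofReal_iff (by linarith)]
    linarith
  · have hsub : (⋃ i, ⋃ b ∈ V i, (b : Set X))ᶜ ⊆ (⋃ i, U i)ᶜ ∪ ((⋃ i, U i) \ K) := by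
      intro x hx
      by_cases hxU : x ∈ ⋃ i, U i
      · refine Or.inr ⟨hxU, fun hxK => hx ?_⟩
        obtain ⟨i, hi⟩ := Set.mem_iUnion.1 hxU
        exact Set.mem_iUnion.2 ⟨i, hV1 i ⟨hxK, hi⟩⟩
      · exact Or.inl hxU
    calc (p : Measure X) (⋃ i, ⋃ b ∈ V i, (b : Set X))ᶜ
        ≤ (p : Measure X) (⋃ i, U i)ᶜ + (p : Measure X) ((⋃ i, U i) \ K) :=
          (measure_mono hsub).trans (measure_union_le _ _)
      _ < ENNReal.ofReal η + (ENNReal.ofReal η' - ENNReal.ofReal η) :=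
          ENNReal.add_lt_add_of_le_of_lt (measure_ne_top _ _) hp hKp
      _ = ENNReal.ofReal η' := add_tsub_cancel_of_le hηlt.le

/-- `Ψ_k` is measurable. In its definition the scales may be restricted to rational ones and the
covering numbers replaced by strict ones, as covering numbers are monotone in the scale. -/
theorem measurable_Psi [CompleteSpace X] {k : ℕ} (hk : 2 < k) :
    Measurable (Psi k : ProbabilityMeasure X → ℝ≥0∞) := by
  have hk' : (2 : ℝ) < k := by exact_mod_cast hk
  set α : ℝ := (k : ℝ) / ((k : ℝ) - 2) with hα
  have hα0 : 0 < α := div_pos (by linarith) (by linarith)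
  have key : ∀ p : ProbabilityMeasure X,
      (⨆ ε ∈ Set.Ioc (0 : ℝ) 1, ENNReal.ofReal (ε ^ k) * (coverNumber ε (ε ^ α) p : ℝ≥0∞)) =
      ⨆ q : {q : ℚ // 0 < q ∧ q ≤ 1}, ENNReal.ofReal (((q : ℚ) : ℝ) ^ k) *
        strictCoverNumber ((q : ℚ) : ℝ) (((q : ℚ) : ℝ) ^ α) p := by
    intro p
    refine le_antisymm (iSup₂_le fun ε hε => ?_) (iSup_le fun ⟨q, hq0, hq1⟩ => ?_)
    · refine ofReal_pow_mul_le_of_forall_lt hε.1 k fun x hx0 hxε => ?_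
      obtain ⟨q, hxq, hqε⟩ := exists_rat_btwn hxε
      have hq0 : (0 : ℝ) < q := hx0.trans hxq
      refine le_trans ?_ (le_iSup _ (⟨q, by exact_mod_cast hq0,
        by exact_mod_cast (hqε.trans_le hε.2).le⟩ : {q : ℚ // 0 < q ∧ q ≤ 1}))
      refine mul_le_mul' (ENNReal.ofReal_le_ofReal (pow_le_pow_left₀ hx0.le hxq.le k)) ?_
      refine le_trans ?_ (coverNumber_le_strictCoverNumber _ _ p)
      exact ENat.toENNReal_le.2
        (coverNumber_anti hqε.le (Real.rpow_le_rpow hq0.le hqε.le hα0.le) p)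
    · have hq0' : (0 : ℝ) < q := by exact_mod_cast hq0
      have hq1' : (q : ℝ) ≤ 1 := by exact_mod_cast hq1
      refine ofReal_pow_mul_le_of_forall_lt hq0' k fun x hx0 hxq => ?_
      refine le_trans ?_ (le_iSup₂ (f := fun (ε : ℝ) (_ : ε ∈ Set.Ioc (0 : ℝ) 1) =>
        ENNReal.ofReal (ε ^ k) * (coverNumber ε (ε ^ α) p : ℝ≥0∞)) x ⟨hx0, hxq.le.trans hq1'⟩)
      exact mul_le_mul' le_rfl (strictCoverNumber_le_coverNumber hx0.le hxq
        (Real.rpow_nonneg hx0.le _) (Real.rpow_lt_rpow hx0.le hxq hα0) p)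
  unfold Psi
  simp_rw [← hα, key]
  exact (Measurable.iSup fun q => (measurable_strictCoverNumber _ _).const_mul _).pow_const _

end

/-! ### The joint law of the directing measure and the observations -/

/-- The σ-algebra on probability measures over a countably generated space is countably generated:
it is generated by the evaluations on a countable `π`-system. -/
instance instCountablyGeneratedProbabilityMeasure {X : Type*} [MeasurableSpace X]
    [MeasurableSpace.CountablyGenerated X] :
    MeasurableSpace.CountablyGenerated (ProbabilityMeasure X) := by
  set A : Finset ℕ → Set X := fun F => ⋂ i ∈ F, MeasurableSpace.natGeneratingSequence X i with hA
  have hAm : ∀ F, MeasurableSet (A F) := fun F =>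
    Finset.measurableSet_biInter _ fun i _ => MeasurableSpace.measurableSet_natGeneratingSequence i
  have hgen : ‹MeasurableSpace X› = MeasurableSpace.generateFrom (Set.range A) := by
    refine le_antisymm ?_ (MeasurableSpace.generateFrom_le ?_)
    · conv_lhs => rw [← MeasurableSpace.generateFrom_natGeneratingSequence X]
      refine MeasurableSpace.generateFrom_mono ?_
      rintro _ ⟨i, rfl⟩
      exact ⟨{i}, by simp [hA]⟩
    · rintro _ ⟨F, rfl⟩
      exact hAm F
  have hpi : IsPiSystem (Set.range A) := by
    classical
    rintro _ ⟨F, rfl⟩ _ ⟨F', rfl⟩ -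
    refine ⟨F ∪ F', ?_⟩
    ext x
    simp [hA, or_imp, forall_and]
  set φ : ProbabilityMeasure X → Finset ℕ → ℝ≥0∞ := fun p F => (p : Measure X) (A F)
  have hle : (ProbabilityMeasure.instMeasurableSpace : MeasurableSpace (ProbabilityMeasure X)) =
      MeasurableSpace.comap φ inferInstance := by
    refine le_antisymm ?_ (Measurable.comap_le (measurable_pi_lambda _ fun F =>
      (Measure.measurable_coe (hAm F)).comp measurable_subtype_coe))
    refine Measurable.comap_le (m₁ := MeasurableSpace.comap φ inferInstance) ?_
    refine @Measurable.measure_of_isPiSystem_of_isProbabilityMeasure _ _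
      (MeasurableSpace.comap φ inferInstance) _ _ (fun p => p.2) _ hgen hpi ?_
    rintro _ ⟨F, rfl⟩
    exact (measurable_pi_apply F).comp (comap_measurable φ)
  rw [hle]
  exact MeasurableSpace.CountablyGenerated.comap φ

lemma ext_of_isPiSystem_prod {α β : Type*} [MeasurableSpace α] [MeasurableSpace β]
    {C : Set (Set α)} {D : Set (Set β)} (hC : MeasurableSpace.generateFrom C = ‹_›)
    (hD : MeasurableSpace.generateFrom D = ‹_›) (hCpi : IsPiSystem C) (hDpi : IsPiSystem D)
    (hCu : Set.univ ∈ C) (hDu : Set.univ ∈ D) {μ ν : Measure (α × β)} [IsFiniteMeasure μ]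
    (h : ∀ s ∈ C, ∀ t ∈ D, μ (s ×ˢ t) = ν (s ×ˢ t)) : μ = ν := by
  refine ext_of_generate_finite _ (generateFrom_eq_prod hC hD
    ⟨fun _ => Set.univ, fun _ => hCu, Set.iUnion_const _⟩
    ⟨fun _ => Set.univ, fun _ => hDu, Set.iUnion_const _⟩).symm (hCpi.prod hDpi) ?_ ?_
  · rintro _ ⟨s, hs, t, ht, rfl⟩
    exact h s hs t ht
  · simpa using h _ hCu _ hDu

/-- The measurable boxes in `ι → X`. -/
def boxes (ι X : Type*) [MeasurableSpace X] : Set (Set (ι → X)) :=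
  Set.pi Set.univ '' Set.pi Set.univ fun _ => {s : Set X | MeasurableSet s}

lemma univ_mem_boxes (ι X : Type*) [MeasurableSpace X] : Set.univ ∈ boxes ι X :=
  ⟨fun _ => Set.univ, fun _ _ => MeasurableSet.univ, Set.pi_univ _⟩

/-- The kernel `p ↦ p ⊗ ⋯ ⊗ p`, the law of an independent sample from `p`. -/
noncomputable def sampleKernel (ι X : Type*) [Fintype ι] [MeasurableSpace X] :
    Kernel (ProbabilityMeasure X) (ι → X) where
  toFun p := Measure.pi fun _ => (p : Measure X)
  measurable' := by
    refine Measurable.measure_of_isPiSystem_of_isProbabilityMeasure generateFrom_pi.symm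
      isPiSystem_pi ?_
    rintro _ ⟨A, hA, rfl⟩
    simp only [Measure.pi_pi]
    exact Finset.measurable_prod _ fun i _ =>
      (Measure.measurable_coe (hA i (Set.mem_univ i))).comp measurable_subtype_coe

lemma sampleKernel_apply {ι X : Type*} [Fintype ι] [MeasurableSpace X] (p : ProbabilityMeasure X) :
    sampleKernel ι X p = Measure.pi fun _ => (p : Measure X) := rfl

instance {ι X : Type*} [Fintype ι] [MeasurableSpace X] : IsMarkovKernel (sampleKernel ι X) :=
  ⟨fun p => by rw [sampleKernel_apply]; infer_instance⟩

section

variable {Ω X : Type*} [MeasurableSpace Ω] [MeasurableSpace X] {P : Measure Ω}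
  {ξ : ℕ → Ω → X} {pt : Ω → ProbabilityMeasure X}

lemma IsDirectedBy.measurable_initial (hξ : IsDirectedBy P ξ pt) (n : ℕ) :
    Measurable (initial ξ n) :=
  measurable_pi_lambda _ fun i => hξ.measurable_obs i

variable [IsProbabilityMeasure P]

lemma IsDirectedBy.measure_inter_eq (hξ : IsDirectedBy P ξ pt) (n : ℕ) {A : ℕ → Set X}
    (hA : ∀ i, MeasurableSet (A i)) {B : Set (ProbabilityMeasure X)} (hB : MeasurableSet B) :
    P (pt ⁻¹' B ∩ ⋂ i ∈ Finset.range n, ξ i ⁻¹' A i) =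
      ∫⁻ ω in pt ⁻¹' B, ∏ i ∈ Finset.range n, (pt ω : Measure X) (A i) ∂P := by
  set S := ⋂ i ∈ Finset.range n, ξ i ⁻¹' A i
  have hS : MeasurableSet S :=
    Finset.measurableSet_biInter _ fun i _ => hξ.measurable_obs i (hA i)
  have hle : MeasurableSpace.comap pt inferInstance ≤ (inferInstance : MeasurableSpace Ω) :=
    hξ.measurable_pt.comap_le
  have h1 := setIntegral_condExp hle (μ := P) (f := S.indicator fun _ => (1 : ℝ))
    ((integrable_const 1).indicator hS) (s := pt ⁻¹' B) ⟨B, hB, rfl⟩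
  rw [setIntegral_congr_ae (g := fun ω => ∏ i ∈ Finset.range n, (pt ω : Measure X).real (A i))
    (hξ.measurable_pt hB) ((hξ.condIID n A hA).mono fun ω h _ => h),
    setIntegral_indicator hS, setIntegral_const, smul_eq_mul, mul_one] at h1
  have hm : Measurable fun ω => ∏ i ∈ Finset.range n, (pt ω : Measure X).real (A i) :=
    Finset.measurable_prod _ fun i _ => ((Measure.measurable_coe (hA i)).comp
      (measurable_subtype_coe.comp hξ.measurable_pt)).ennreal_toReal
  have hi : Integrable (fun ω => ∏ i ∈ Finset.range n, (pt ω : Measure X).real (A i))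
      (P.restrict (pt ⁻¹' B)) := by
    refine Integrable.of_bound hm.aestronglyMeasurable 1 (ae_of_all _ fun ω => ?_)
    rw [Real.norm_eq_abs, abs_of_nonneg (Finset.prod_nonneg fun _ _ => measureReal_nonneg)]
    exact Finset.prod_le_one (fun _ _ => measureReal_nonneg) fun _ _ => measureReal_le_one
  rw [← ENNReal.ofReal_toReal (measure_ne_top P (pt ⁻¹' B ∩ S)), ← measureReal_def, ← h1,
    ofReal_integral_eq_lintegral_ofReal hi
      (ae_of_all _ fun ω => Finset.prod_nonneg fun _ _ => measureReal_nonneg)]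
  refine lintegral_congr fun ω => ?_
  rw [ENNReal.ofReal_prod_of_nonneg fun _ _ => measureReal_nonneg]
  exact Finset.prod_congr rfl fun i _ => ENNReal.ofReal_toReal (measure_ne_top _ _)

/-- Given `pt`, the first `n` observations are an independent sample from `pt`. -/
lemma IsDirectedBy.hasCondDistrib_initial (hξ : IsDirectedBy P ξ pt) (n : ℕ) :
    HasCondDistrib (initial ξ n) pt (sampleKernel (Fin n) X) P := by
  have hinit := hξ.measurable_initial n
  have hpt := hξ.measurable_pt
  refine ⟨(hpt.prodMk hinit).aemeasurable, ?_⟩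
  have := Measure.isProbabilityMeasure_map (μ := P) hpt.aemeasurable
  have := Measure.isProbabilityMeasure_map (μ := P) (hpt.prodMk hinit).aemeasurable
  refine ext_of_isPiSystem_prod (C := {s | MeasurableSet s}) (D := boxes (Fin n) X)
    (MeasurableSpace.generateFrom_measurableSet) generateFrom_pi
    MeasurableSpace.isPiSystem_measurableSet isPiSystem_pi MeasurableSet.univ
    (univ_mem_boxes _ _) ?_
  rintro B hB _ ⟨A, hA, rfl⟩
  replace hB : MeasurableSet B := by simpa using hB
  have hA' : ∀ i, MeasurableSet (A i) := fun i => hA i (Set.mem_univ i)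
  set A' : ℕ → Set X := fun i => if h : i < n then A ⟨i, h⟩ else Set.univ with hA'def
  have hA'm : ∀ i, MeasurableSet (A' i) := by
    intro i
    simp only [hA'def]
    split_ifs
    exacts [hA' _, MeasurableSet.univ]
  have hbox : MeasurableSet (Set.univ.pi A) := MeasurableSet.univ_pi hA'
  rw [Measure.map_apply (hpt.prodMk hinit) (hB.prod hbox),
    Measure.compProd_apply_prod hB hbox, setLIntegral_map hB
      (Kernel.measurable_coe _ hbox) hpt]
  have hset : (fun ω => (pt ω, initial ξ n ω)) ⁻¹' (B ×ˢ Set.univ.pi A) =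
      pt ⁻¹' B ∩ ⋂ i ∈ Finset.range n, ξ i ⁻¹' A' i := by
    ext ω
    simp only [Set.mem_preimage, Set.mem_prod, Set.mem_univ_pi, Set.mem_inter_iff, Set.mem_iInter,
      Finset.mem_range, initial, hA'def]
    refine and_congr_right fun _ => ⟨fun h i hi => by simpa [hi] using h ⟨i, hi⟩,
      fun h i => by simpa using h i i.2⟩
  rw [hset, hξ.measure_inter_eq n hA'm hB]
  refine lintegral_congr fun ω => ?_
  rw [sampleKernel_apply, Measure.pi_pi, Finset.prod_range]
  exact Finset.prod_congr rfl fun i _ => by simp [hA'def]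

/-- Given the first `n` observations and `pt`, the next `r` ones are an independent sample
from `pt`. -/
lemma IsDirectedBy.hasCondDistrib_next (hξ : IsDirectedBy P ξ pt) (n r : ℕ) :
    HasCondDistrib (fun ω (j : Fin r) => ξ (n + j) ω) (fun ω => (initial ξ n ω, pt ω))
      (Kernel.prodMkLeft (Fin n → X) (sampleKernel (Fin r) X)) P := by
  have hinit := hξ.measurable_initial n
  have hpt := hξ.measurable_pt
  have hy : Measurable fun ω (j : Fin r) => ξ (n + j) ω :=
    measurable_pi_lambda _ fun j => hξ.measurable_obs _
  have hip := hinit.prodMk hpt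
  refine ⟨(hip.prodMk hy).aemeasurable, ?_⟩
  have := Measure.isProbabilityMeasure_map (μ := P) hip.aemeasurable
  have := Measure.isProbabilityMeasure_map (μ := P) (hip.prodMk hy).aemeasurable
  refine ext_of_isPiSystem_prod
    (C := Set.image2 (· ×ˢ ·) (boxes (Fin n) X) {s : Set (ProbabilityMeasure X) | MeasurableSet s})
    (D := boxes (Fin r) X)
    (generateFrom_eq_prod generateFrom_pi MeasurableSpace.generateFrom_measurableSet
      ⟨fun _ => Set.univ, fun _ => univ_mem_boxes _ _, Set.iUnion_const _⟩
      ⟨fun _ => Set.univ, fun _ => by simp, Set.iUnion_const _⟩)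
    generateFrom_pi (isPiSystem_pi.prod MeasurableSpace.isPiSystem_measurableSet) isPiSystem_pi
    ⟨_, univ_mem_boxes _ _, Set.univ, by simp, Set.univ_prod_univ⟩ (univ_mem_boxes _ _) ?_
  rintro _ ⟨_, ⟨A, hA, rfl⟩, B, hB, rfl⟩ _ ⟨A', hA', rfl⟩
  replace hA : ∀ i, MeasurableSet (A i) := fun i => hA i (Set.mem_univ i)
  replace hA' : ∀ i, MeasurableSet (A' i) := fun i => hA' i (Set.mem_univ i)
  replace hB : MeasurableSet B := by simpa using hB
  have hbox : MeasurableSet (Set.univ.pi A) := MeasurableSet.univ_pi hA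
  have hbox' : MeasurableSet (Set.univ.pi A') := MeasurableSet.univ_pi hA'
  set g : ProbabilityMeasure X → ℝ≥0∞ := fun p => ∏ j, (p : Measure X) (A' j) with hg
  have hgm : Measurable g := Finset.measurable_prod _ fun j _ =>
    (Measure.measurable_coe (hA' j)).comp measurable_subtype_coe
  -- the sets `A i` followed by the sets `A' j`
  set S : ℕ → Set X := fun i => if h : i < n + r then Fin.append A A' ⟨i, h⟩ else Set.univ with hS
  have hSm : ∀ i, MeasurableSet (S i) := by
    intro i
    simp only [hS]
    split_ifs with h
    · induction (⟨i, h⟩ : Fin (n + r)) using Fin.addCases with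
      | left i => rw [Fin.append_left]; exact hA i
      | right j => rw [Fin.append_right]; exact hA' j
    · exact MeasurableSet.univ
  have hSl : ∀ i : Fin n, S i = A i := fun i => by
    have : (i : ℕ) < n + r := by lia
    simp only [hS, this, dif_pos]
    exact Fin.append_left A A' i
  have hSr : ∀ j : Fin r, S (n + j) = A' j := fun j => by
    have : n + (j : ℕ) < n + r := by lia
    simp only [hS, this, dif_pos]
    exact Fin.append_right A A' j
  have hset : (fun ω => ((initial ξ n ω, pt ω), fun j : Fin r => ξ (n + j) ω)) ⁻¹'
      ((Set.univ.pi A ×ˢ B) ×ˢ Set.univ.pi A') =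
      pt ⁻¹' B ∩ ⋂ i ∈ Finset.range (n + r), ξ i ⁻¹' S i := by
    ext ω
    simp only [Set.mem_preimage, Set.mem_prod, Set.mem_univ_pi, Set.mem_inter_iff, Set.mem_iInter,
      Finset.mem_range, initial]
    constructor
    · rintro ⟨⟨h1, h2⟩, h3⟩
      refine ⟨h2, fun i hi => ?_⟩
      by_cases hin : i < n
      · simpa [hSl ⟨i, hin⟩] using h1 ⟨i, hin⟩
      · obtain ⟨j, rfl⟩ := Nat.exists_eq_add_of_le (not_lt.1 hin)
        have hj : j < r := by lia
        have := h3 ⟨j, hj⟩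
        rw [← hSr] at this
        exact this
    · rintro ⟨h2, h⟩
      refine ⟨⟨fun i => hSl i ▸ h i (by lia), h2⟩, fun j => hSr j ▸ h (n + j) (by lia)⟩
  rw [Measure.map_apply (hip.prodMk hy) ((hbox.prod hB).prod hbox'), hset,
    hξ.measure_inter_eq _ hSm hB, Measure.compProd_apply_prod (hbox.prod hB) hbox']
  have hker : ∀ z : (Fin n → X) × ProbabilityMeasure X,
      Kernel.prodMkLeft (Fin n → X) (sampleKernel (Fin r) X) z (Set.univ.pi A') = g z.2 := by
    intro z
    rw [Kernel.prodMkLeft_apply, sampleKernel_apply, Measure.pi_pi]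
  simp_rw [hker]
  have hgm1 : Measurable fun z : ProbabilityMeasure X × (Fin n → X) => g z.1 :=
    hgm.comp measurable_fst
  have hgm2 : Measurable fun z : (Fin n → X) × ProbabilityMeasure X => g z.2 :=
    hgm.comp measurable_snd
  rw [setLIntegral_map (hbox.prod hB) hgm2 hip]
  -- exchange the roles of `pt` and the first observations, and integrate the latter given `pt`
  have hswap : (fun ω => (initial ξ n ω, pt ω)) ⁻¹' (Set.univ.pi A ×ˢ B) =
      (fun ω => (pt ω, initial ξ n ω)) ⁻¹' (B ×ˢ Set.univ.pi A) := by
    ext ω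
    simp [and_comm]
  have hpi := hpt.prodMk hinit
  calc ∫⁻ ω in pt ⁻¹' B, ∏ i ∈ Finset.range (n + r), (pt ω : Measure X) (S i) ∂P
      = ∫⁻ ω in pt ⁻¹' B, g (pt ω) * sampleKernel (Fin n) X (pt ω) (Set.univ.pi A) ∂P := by
        refine lintegral_congr fun ω => ?_
        rw [Finset.prod_range_add, mul_comm, Finset.prod_range, Finset.prod_range,
          sampleKernel_apply, Measure.pi_pi]
        simp only [hSl, hSr, hg]
    _ = ∫⁻ p in B, g p * sampleKernel (Fin n) X p (Set.univ.pi A) ∂(P.map pt) :=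
        (setLIntegral_map hB (hgm.mul (Kernel.measurable_coe _ hbox)) hpt).symm
    _ = ∫⁻ z in B ×ˢ Set.univ.pi A, g z.1 ∂(P.map pt ⊗ₘ sampleKernel (Fin n) X) := by
        have := Measure.isProbabilityMeasure_map (μ := P) hpt.aemeasurable
        rw [Measure.setLIntegral_compProd hgm1 hB hbox]
        refine lintegral_congr fun p => ?_
        simp
    _ = ∫⁻ ω in (fun ω => (initial ξ n ω, pt ω)) ⁻¹' (Set.univ.pi A ×ˢ B), g (pt ω) ∂P := by
        rw [← (hξ.hasCondDistrib_initial n).map_eq,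
          setLIntegral_map (hB.prod hbox) hgm1 hpi, hswap]

end

/-! ### Coupling the posterior with the predictive law of the empirical measure -/

lemma empirical_add_eq_empiricalOf {Ω X : Type*} [MeasurableSpace X] (ξ : ℕ → Ω → X) (n r : ℕ)
    [Nonempty (Fin r)] (h : 0 < n + r) (ω : Ω) :
    empirical (fun i => ξ i ω) (n + r) h =
      empiricalOf (Sum.elim (initial ξ n ω) fun j : Fin r => ξ (n + j) ω) := by
  refine Subtype.ext ?_
  change ((n + r : ℕ) : ℝ≥0∞)⁻¹ • ∑ i ∈ Finset.range (n + r), Measure.dirac (ξ i ω) =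
    (Fintype.card (Fin n ⊕ Fin r) : ℝ≥0∞)⁻¹ • ∑ i, Measure.dirac (Sum.elim _ _ i)
  rw [Fintype.sum_sum_type, Finset.sum_range_add, Finset.sum_range, Finset.sum_range]
  simp [initial]

/-- Prepending `n` points to a sample of size `r` changes its empirical measure by at most
`2 n / (n + r)`. -/
lemma blDist_empiricalOf_sumElim_le {X : Type*} [MetricSpace X] [MeasurableSpace X]
    [BorelSpace X] {n r : ℕ} [Nonempty (Fin r)] (p : ProbabilityMeasure X) (x : Fin n → X)
    (y : Fin r → X) : blDist p (empiricalOf (Sum.elim x y)) ≤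
      blDist p (empiricalOf y) + 2 * (n : ℝ≥0∞) / ((n + r : ℕ) : ℝ≥0∞) := by
  have hr : 0 < r := Fin.pos_iff_nonempty.2 inferInstance
  refine iSup₂_le fun f hf => ?_
  obtain ⟨hf1, -⟩ := bounded_lipschitz_of_blNorm_le_one hf
  have hle : ENNReal.ofReal (∫ z, f z ∂(p : Measure X) -
      ∫ z, f z ∂(empiricalOf y : Measure X)) ≤ blDist p (empiricalOf y) :=
    le_iSup₂ (f := fun (f : X → ℝ) (_ : blNorm f ≤ 1) => ENNReal.ofReal
      (∫ z, f z ∂(p : Measure X) - ∫ z, f z ∂(empiricalOf y : Measure X))) f hf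
  have he : 2 * (n : ℝ≥0∞) / ((n + r : ℕ) : ℝ≥0∞) =
      ENNReal.ofReal (2 * n / ((n + r : ℕ) : ℝ)) := by
    rw [ENNReal.ofReal_div_of_pos (by positivity), ENNReal.ofReal_mul (by norm_num),
      ENNReal.ofReal_natCast, ENNReal.ofReal_natCast, ENNReal.ofReal_ofNat]
  rw [he]
  refine le_trans ?_ (add_le_add hle le_rfl)
  refine le_trans (ENNReal.ofReal_le_ofReal ?_) ENNReal.ofReal_add_le
  rw [integral_empiricalOf, integral_empiricalOf, Fintype.sum_sum_type]
  simp only [Sum.elim_inl, Sum.elim_inr, Fintype.card_sum, Fintype.card_fin]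
  have hA : |∑ i, f (x i)| ≤ n := (Finset.abs_sum_le_sum_abs _ _).trans
    ((Finset.sum_le_sum fun i _ => hf1 _).trans (by simp))
  have hB : |∑ j, f (y j)| ≤ r := (Finset.abs_sum_le_sum_abs _ _).trans
    ((Finset.sum_le_sum fun i _ => hf1 _).trans (by simp))
  set A := ∑ i, f (x i)
  set B := ∑ j, f (y j)
  have hr' : (0 : ℝ) < r := by exact_mod_cast hr
  have hn' : (0 : ℝ) ≤ n := n.cast_nonneg
  have key : (r : ℝ)⁻¹ * B - ((n + r : ℕ) : ℝ)⁻¹ * (A + B) ≤ 2 * n / ((n + r : ℕ) : ℝ) := by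
    push_cast
    have e : (r : ℝ)⁻¹ * B - ((n : ℝ) + r)⁻¹ * (A + B) = (B / r * n - A) / (n + r) := by
      field_simp
      ring
    rw [e]
    have h1 : B / r ≤ 1 := (div_le_one hr').2 ((le_abs_self _).trans hB)
    have h2 := (abs_le.1 hA).1
    gcongr
    nlinarith
  linarith

/-- For a function that need not be measurable, the iterated integral still bounds the integral
against a composition-product from above. -/
lemma lintegral_kernel_compProd_le {α β γ : Type*} [MeasurableSpace α] [MeasurableSpace β]
    [MeasurableSpace γ] (κ : Kernel α β) [IsSFiniteKernel κ] (η : Kernel (α × β) γ)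
    [IsSFiniteKernel η] (a : α) (f : β × γ → ℝ≥0∞) :
    ∫⁻ z, f z ∂(κ ⊗ₖ η) a ≤ ∫⁻ b, ∫⁻ c, f (b, c) ∂η (a, b) ∂κ a := by
  obtain ⟨g, hg, hgf, hge⟩ := exists_measurable_le_lintegral_eq ((κ ⊗ₖ η) a) f
  rw [hge, Kernel.lintegral_compProd _ _ _ hg]
  exact lintegral_mono fun b => lintegral_mono fun c => hgf _

/-- The coupling: draw `p` from the posterior `Q x` and `r` further observations from `p`. -/
lemma wasserstein_map_empiricalOf_le {X : Type*} [MetricSpace X] [SecondCountableTopology X]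
    [CompleteSpace X] [MeasurableSpace X] [BorelSpace X] {n r : ℕ} [Nonempty (Fin r)] {k : ℕ}
    (hk : 2 < k) (Q : Kernel (Fin n → X) (ProbabilityMeasure X)) [IsMarkovKernel Q]
    (x : Fin n → X) :
    wasserstein (Q x) (((Q ⊗ₖ Kernel.prodMkLeft (Fin n → X) (sampleKernel (Fin r) X)) x).map
        fun z => empiricalOf (Sum.elim x z.2)) ≤
      (r : ℝ≥0∞) ^ (-(1 / (k : ℝ))) * (3 ^ (2 * k) * ∫⁻ p, Psi k p ∂Q x) +
        2 * (n : ℝ≥0∞) / ((n + r : ℕ) : ℝ≥0∞) := by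
  set η := Kernel.prodMkLeft (Fin n → X) (sampleKernel (Fin r) X)
  have hg : Measurable fun z : ProbabilityMeasure X × (Fin r → X) =>
      empiricalOf (Sum.elim x z.2) := by
    refine measurable_empiricalOf.comp (measurable_pi_lambda _ ?_)
    rintro (i | j)
    · exact measurable_const
    · exact (measurable_pi_apply j).comp measurable_snd
  set Γ := ((Q ⊗ₖ η) x).map fun z => (z.1, empiricalOf (Sum.elim x z.2))
  have h1 : Γ.map Prod.fst = Q x := by
    rw [Measure.map_map measurable_fst (measurable_fst.prodMk hg)]
    change ((Q ⊗ₖ η) x).map Prod.fst = Q x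
    rw [← Kernel.fst_apply, Kernel.fst_compProd]
  have h2 : Γ.map Prod.snd = ((Q ⊗ₖ η) x).map fun z => empiricalOf (Sum.elim x z.2) := by
    rw [Measure.map_map measurable_snd (measurable_fst.prodMk hg)]
    rfl
  refine (iInf₂_le Γ ⟨h1, h2⟩).trans ((lintegral_map_le _ _).trans ?_)
  refine (lintegral_kernel_compProd_le Q η x _).trans ?_
  have hbound : ∀ p : ProbabilityMeasure X,
      ∫⁻ y, blDist p (empiricalOf (Sum.elim x y)) ∂η (x, p) ≤
        (r : ℝ≥0∞) ^ (-(1 / (k : ℝ))) * (3 ^ (2 * k) * Psi k p) +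
          2 * (n : ℝ≥0∞) / ((n + r : ℕ) : ℝ≥0∞) := by
    intro p
    calc ∫⁻ y, blDist p (empiricalOf (Sum.elim x y)) ∂η (x, p)
        ≤ ∫⁻ y, blDist p (empiricalOf y) + 2 * (n : ℝ≥0∞) / ((n + r : ℕ) : ℝ≥0∞) ∂η (x, p) :=
          lintegral_mono fun y => blDist_empiricalOf_sumElim_le p x y
      _ = ∫⁻ y, blDist p (empiricalOf y) ∂η (x, p) + 2 * (n : ℝ≥0∞) / ((n + r : ℕ) : ℝ≥0∞) := by
          rw [lintegral_add_right _ measurable_const]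
          simp
      _ ≤ _ := by
          refine add_le_add ?_ le_rfl
          have := lintegral_blDist_empiricalOf_le (ι := Fin r) p hk
          rwa [Fintype.card_fin] at this
  refine (lintegral_mono hbound).trans_eq ?_
  rw [lintegral_add_right _ measurable_const, lintegral_const_mul _
    ((measurable_Psi hk).const_mul _), lintegral_const_mul _ (measurable_Psi hk)]
  simp

lemma compProd_prod_id_map {α β γ : Type*} [MeasurableSpace α] [MeasurableSpace β]
    [MeasurableSpace γ] (μ : Measure α) [SFinite μ] (κ : Kernel α β) [IsSFiniteKernel κ]
    {g : α × β → γ} (hg : Measurable g) :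
    μ ⊗ₘ ((Kernel.id ×ₖ κ).map g) = (μ ⊗ₘ κ).map fun z => (z.1, g z) := by
  ext s hs
  have hm : Measurable fun z : α × β => (z.1, g z) := measurable_fst.prodMk hg
  rw [Measure.compProd_apply hs, Measure.map_apply hm hs, Measure.compProd_apply (hm hs)]
  refine lintegral_congr fun a => ?_
  rw [Kernel.map_apply' _ hg _ (measurable_prodMk_left hs), Kernel.prod_apply, Kernel.id_apply,
    Measure.dirac_prod, Measure.map_apply measurable_prodMk_left (hg (measurable_prodMk_left hs))]
  rfl

section

variable {Ω X : Type*} [MeasurableSpace Ω] {P : Measure Ω} [IsProbabilityMeasure P]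
  {ξ : ℕ → Ω → X}

/-- Almost surely, the conditional law of the empirical measure is obtained by drawing a
probability measure from the posterior and then the missing observations from that measure. -/
lemma IsDirectedBy.ae_eq_map_empiricalOf [MeasurableSpace X] [MeasurableSpace.CountablyGenerated X]
    {pt : Ω → ProbabilityMeasure X} (hξ : IsDirectedBy P ξ pt) {n r : ℕ} [Nonempty (Fin r)]
    (h : 0 < n + r) {Q R : Kernel (Fin n → X) (ProbabilityMeasure X)} [IsMarkovKernel Q]
    [IsMarkovKernel R] (hQ : HasCondDistrib pt (initial ξ n) Q P)
    (hR : HasCondDistrib (fun ω => empirical (fun i => ξ i ω) (n + r) h) (initial ξ n) R P) :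
    ∀ᵐ ω ∂P, R (initial ξ n ω) =
      ((Q ⊗ₖ Kernel.prodMkLeft (Fin n → X) (sampleKernel (Fin r) X)) (initial ξ n ω)).map
        fun z => empiricalOf (Sum.elim (initial ξ n ω) z.2) := by
  set η := Kernel.prodMkLeft (Fin n → X) (sampleKernel (Fin r) X)
  set μ := P.map (initial ξ n)
  have hinit := hξ.measurable_initial n
  have hy : Measurable fun ω (j : Fin r) => ξ (n + j) ω :=
    measurable_pi_lambda _ fun j => hξ.measurable_obs _
  have hμ : IsProbabilityMeasure μ := Measure.isProbabilityMeasure_map hinit.aemeasurable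
  set g : (Fin n → X) × (ProbabilityMeasure X × (Fin r → X)) → ProbabilityMeasure X :=
    fun z => empiricalOf (Sum.elim z.1 z.2.2) with hgdef
  have hg : Measurable g := by
    refine measurable_empiricalOf.comp (measurable_pi_lambda _ ?_)
    rintro (i | j)
    · exact (measurable_pi_apply i).comp measurable_fst
    · exact (measurable_pi_apply j).comp (measurable_snd.comp measurable_snd)
  have hjoint : P.map (fun ω => (initial ξ n ω, (pt ω, fun j : Fin r => ξ (n + j) ω))) =
      μ ⊗ₘ (Q ⊗ₖ η) := by
    have h1 := (hξ.hasCondDistrib_next n r).map_eq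
    rw [hQ.map_eq, ← Measure.compProd_assoc] at h1
    have h2 := congrArg (Measure.map MeasurableEquiv.prodAssoc) h1
    rw [Measure.map_map MeasurableEquiv.prodAssoc.measurable
        ((hinit.prodMk hξ.measurable_pt).prodMk hy),
      Measure.map_map MeasurableEquiv.prodAssoc.measurable
        MeasurableEquiv.prodAssoc.symm.measurable,
      MeasurableEquiv.self_comp_symm, Measure.map_id] at h2
    exact h2
  have hlaw : μ ⊗ₘ R = μ ⊗ₘ ((Kernel.id ×ₖ (Q ⊗ₖ η)).map g) := by
    rw [compProd_prod_id_map _ _ hg, ← hjoint,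
      Measure.map_map (measurable_fst.prodMk hg) (hinit.prodMk (hξ.measurable_pt.prodMk hy)),
      ← hR.map_eq]
    congr 1
    funext ω
    simp only [Function.comp_apply, hgdef, empirical_add_eq_empiricalOf]
  have hgk : IsMarkovKernel ((Kernel.id ×ₖ (Q ⊗ₖ η)).map g) := Kernel.IsMarkovKernel.map _ hg
  filter_upwards [ae_of_ae_map hinit.aemeasurable (Kernel.ae_eq_of_compProd_eq hlaw)] with ω hω
  rw [hω, Kernel.map_apply _ hg, Kernel.prod_apply, Kernel.id_apply, Measure.dirac_prod,
    Measure.map_map hg measurable_prodMk_left]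
  rfl

/-! ### Conditional expectations of `Ψ_k` -/

variable [MetricSpace X] [SecondCountableTopology X] [CompleteSpace X] [MeasurableSpace X]
  [BorelSpace X] {pt : Ω → ProbabilityMeasure X}

lemma IsDirectedBy.lintegral_posterior_ae_eq_condPsi (hξ : IsDirectedBy P ξ pt) {k : ℕ}
    (hk : 2 < k) {n : ℕ} {Q : Kernel (Fin n → X) (ProbabilityMeasure X)} [IsMarkovKernel Q]
    (hQ : HasCondDistrib pt (initial ξ n) Q P) :
    (fun ω => ∫⁻ p, Psi k p ∂Q (initial ξ n ω)) =ᵐ[P] condPsi P ξ pt k n := by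
  have hinit := hξ.measurable_initial n
  have hm : Measurable fun x => ∫⁻ p, Psi k p ∂Q x := (measurable_Psi hk).lintegral_kernel
  refine ae_eq_condLExp hinit.comap_le P _ (hm.comp (comap_measurable _)) ?_
  rintro _ ⟨A, hA, rfl⟩
  have := Measure.isProbabilityMeasure_map (μ := P) hinit.aemeasurable
  have hm2 : Measurable fun z : (Fin n → X) × ProbabilityMeasure X => Psi k z.2 :=
    (measurable_Psi hk).comp measurable_snd
  have h2 := setLIntegral_map (μ := P) (hA.prod MeasurableSet.univ) hm2
    (hinit.prodMk hξ.measurable_pt)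
  rw [hQ.map_eq, Measure.setLIntegral_compProd hm2 hA MeasurableSet.univ] at h2
  rw [← setLIntegral_map hA hm hinit]
  simpa [Set.mk_preimage_prod] using h2

/-- The σ-algebras generated by the first observations. -/
def observationFiltration (hξ : IsDirectedBy P ξ pt) :
    Filtration ℕ (inferInstance : MeasurableSpace Ω) where
  seq n := MeasurableSpace.comap (initial ξ n) inferInstance
  mono' m n hmn := by
    have h : initial ξ m = (fun x i => x (Fin.castLE hmn i)) ∘ initial ξ n := rfl
    have hm : Measurable fun (x : Fin n → X) (i : Fin m) => x (Fin.castLE hmn i) :=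
      measurable_pi_lambda _ fun i => measurable_pi_apply _
    change MeasurableSpace.comap (initial ξ m) _ ≤ _
    rw [h, ← MeasurableSpace.comap_comp]
    exact MeasurableSpace.comap_mono hm.comap_le
  le' n := (hξ.measurable_initial n).comap_le

/-- By Lévy's upward theorem the conditional expectations of `Ψ_k` converge almost surely. -/
lemma IsDirectedBy.ae_iSup_condPsi_lt_top (hξ : IsDirectedBy P ξ pt) {k : ℕ} (hk : 2 < k)
    (hΨ : ∫⁻ ω, Psi k (pt ω) ∂P < ∞) : ∀ᵐ ω ∂P, ⨆ n, condPsi P ξ pt k n ω < ∞ := by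
  have hm : Measurable fun ω => Psi k (pt ω) := (measurable_Psi hk).comp hξ.measurable_pt
  have hreal : ∀ᵐ ω ∂P, ∀ n, (condPsi P ξ pt k n ω).toReal =
      P[fun ω => (Psi k (pt ω)).toReal | observationFiltration hξ n] ω :=
    ae_all_iff.2 fun n => toReal_condLExp _ hm.aemeasurable hΨ.ne
  have hfin : ∀ᵐ ω ∂P, ∀ n, condPsi P ξ pt k n ω ≠ ∞ :=
    ae_all_iff.2 fun n => condLExp_ne_top hΨ.ne
  filter_upwards [hreal, hfin, tendsto_ae_condExp (ℱ := observationFiltration hξ) (μ := P)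
    fun ω => (Psi k (pt ω)).toReal] with ω h1 h2 h3
  obtain ⟨C, hC⟩ := h3.bddAbove_range
  refine (iSup_le fun n => ?_).trans_lt (ENNReal.ofReal_lt_top (r := C))
  rw [← ENNReal.ofReal_toReal (h2 n), h1 n]
  exact ENNReal.ofReal_le_ofReal (hC ⟨n, rfl⟩)

end

end FinitaryPosterior

theorem mainTheorem5 {d : ℕ} {Ω : Type*} [MeasurableSpace Ω]
    (P : Measure Ω) [IsProbabilityMeasure P]
    (ξ : ℕ → Ω → EuclideanSpace ℝ (Fin d))
    (pt : Ω → ProbabilityMeasure (EuclideanSpace ℝ (Fin d)))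
    (hξ : FinitaryPosterior.IsDirectedBy P ξ pt)
    (k : ℕ) (hk : 2 < k)
    (hΨ : ∫⁻ ω, FinitaryPosterior.Psi k (pt ω) ∂P < ∞)
    -- `Q n` is a version of the posterior, `R n N` of the conditional law of the empirical measure
    (Q : ∀ n : ℕ, Kernel (Fin n → EuclideanSpace ℝ (Fin d))
      (ProbabilityMeasure (EuclideanSpace ℝ (Fin d))))
    [∀ n, IsMarkovKernel (Q n)]
    (hQ : ∀ n, HasCondDistrib pt (FinitaryPosterior.initial ξ n) (Q n) P)
    (R : ∀ n _N : ℕ, Kernel (Fin n → EuclideanSpace ℝ (Fin d))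
      (ProbabilityMeasure (EuclideanSpace ℝ (Fin d))))
    [∀ n N, IsMarkovKernel (R n N)]
    (hR : ∀ n N (h : n < N), HasCondDistrib
      (fun ω => FinitaryPosterior.empirical (fun i => ξ i ω) N (Nat.zero_lt_of_lt h))
      (FinitaryPosterior.initial ξ n) (R n N) P)
    (Y : Ω → ℝ≥0∞)
    (hY : ∀ ω, Y ω = ⨆ (n : ℕ) (_ : 1 ≤ n), FinitaryPosterior.condPsi P ξ pt k n ω) :
    ∀ᵐ ω ∂P, Y ω < ∞ ∧ ∀ n N : ℕ, 1 ≤ n → n < N →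
      FinitaryPosterior.wasserstein
          (Q n (FinitaryPosterior.initial ξ n ω)) (R n N (FinitaryPosterior.initial ξ n ω))
        ≤ ((N - n : ℕ) : ℝ≥0∞) ^ (-(1 / (k : ℝ))) *
            (4 / 3 + 4 * 3 ^ (2 * k) * FinitaryPosterior.condPsi P ξ pt k n ω)
          + 2 * (n : ℝ≥0∞) / (N : ℝ≥0∞) ∧
      ((N - n : ℕ) : ℝ≥0∞) ^ (-(1 / (k : ℝ))) *
            (4 / 3 + 4 * 3 ^ (2 * k) * FinitaryPosterior.condPsi P ξ pt k n ω)
          + 2 * (n : ℝ≥0∞) / (N : ℝ≥0∞)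
        ≤ ((N - n : ℕ) : ℝ≥0∞) ^ (-(1 / (k : ℝ))) * (4 / 3 + 4 * 3 ^ (2 * k) * Y ω)
          + 2 * (n : ℝ≥0∞) / (N : ℝ≥0∞) := by
  have hYtop := hξ.ae_iSup_condPsi_lt_top hk hΨ
  have hpost : ∀ᵐ ω ∂P, ∀ n, ∫⁻ p, FinitaryPosterior.Psi k p
      ∂Q n (FinitaryPosterior.initial ξ n ω) = FinitaryPosterior.condPsi P ξ pt k n ω :=
    ae_all_iff.2 fun n => hξ.lintegral_posterior_ae_eq_condPsi hk (hQ n)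
  have hpred : ∀ᵐ ω ∂P, ∀ n r : ℕ, ∀ _ : Nonempty (Fin r),
      R n (n + r) (FinitaryPosterior.initial ξ n ω) = ((Q n ⊗ₖ Kernel.prodMkLeft _
        (FinitaryPosterior.sampleKernel (Fin r) _)) (FinitaryPosterior.initial ξ n ω)).map fun z =>
          FinitaryPosterior.empiricalOf (Sum.elim (FinitaryPosterior.initial ξ n ω) z.2) := by
    refine ae_all_iff.2 fun n => ae_all_iff.2 fun r => ae_all_iff.2 fun hr => ?_
    have hlt : n < n + r := Nat.lt_add_of_pos_right (Fin.pos_iff_nonempty.2 hr)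
    exact hξ.ae_eq_map_empiricalOf (Nat.zero_lt_of_lt hlt) (hQ n) (hR n (n + r) hlt)
  filter_upwards [hYtop, hpost, hpred] with ω h1 h2 h3
  have hYω : Y ω ≤ ⨆ n, FinitaryPosterior.condPsi P ξ pt k n ω := by
    rw [hY]
    exact iSup₂_le fun n _ => le_iSup (fun n => FinitaryPosterior.condPsi P ξ pt k n ω) n
  refine ⟨hYω.trans_lt h1, fun n N hn hnN => ⟨?_, ?_⟩⟩
  · obtain ⟨r, rfl⟩ := Nat.exists_eq_add_of_lt hnN
    rw [add_assoc, h3 n (r + 1) inferInstance, Nat.add_sub_cancel_left]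
    refine (FinitaryPosterior.wasserstein_map_empiricalOf_le hk (Q n) _).trans ?_
    rw [h2 n]
    refine add_le_add (mul_le_mul' le_rfl (le_add_left ?_)) le_rfl
    rw [mul_assoc]
    exact le_mul_of_one_le_left' (by norm_num)
  · have : FinitaryPosterior.condPsi P ξ pt k n ω ≤ Y ω := by
      rw [hY]
      exact le_iSup₂ (f := fun n (_ : 1 ≤ n) => FinitaryPosterior.condPsi P ξ pt k n ω) n hn
    gcongr
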